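/- Let $\mathfrak g$ be a $4$-dimensional real Lie algebra with a positive definite inner product $g$ (a left-invariant Riemannian metric; its Levi-Civita connection and curvature are computed on left-invariant vector fields). An almost-Kähler structure $(\omega,J,g)$ on $\mathfrak g$ consists of $J\in\mathrm{End}(\mathfrak g)$ with $J^2=-\mathrm{Id}$ and $g(J\cdot,J\cdot)=g$, such that the $2$-form $\omega=g(J\cdot,\cdot)$ is closed, $d\omega=0$, where $d$ is the Chevalley–Eilenberg differential; it is Kähler if moreover $J$ is integrable, i.e. $N_J(x,y)=[Jx,Jy]-J[Jx,y]-J[x,Jy]-[x,y]=0$ for all $x,y$. Orient $\mathfrak g$ by $\omega\wedge\omega$, and let $W^{\pm}$ be the restrictions of the Weyl tensor, as an operator on $2$-forms, to the $\pm1$-eigenspaces $\Lambda^{\pm}$ of the Hodge star. The metric is self-dual if $W^-=0$ and conformally flat if $W^+=W^-=0$. (1) If $(\omega,J,g)$ is an almost-Kähler structure on $\mathfrak g$ and $g$ is self-dual and not conformally flat, then $(\omega,J,g)$ is Kähler. (2) Let $\lambda\ge 0$ and $k\in\{1,2\}$, and suppose that $\mathfrak g$ has a basis $e_1,\dots,e_4$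 whose dual basis satisfies $$de^1=0,\quad de^2=-e^{12}-\lambda e^{13},\quad de^3=\lambda e^{12}-e^{13},\quad de^4=-2e^{14}+e^{23}$$ (with $e^{ij}=e^i\wedge e^j$), and that $\{\tfrac1k e_1,e_2,e_3,e_4\}$ is $g$-orthonormal (the De Smedt–Salamon model). Then a $2$-form $\omega$ belongs to an almost-Kähler structure $(\omega,J,g)$ if and only if $k=2$ and $\omega=-2e^{14}+e^{23}$ or $\omega=2e^{14}-e^{23}$. Moreover, for every almost-Kähler structure $(\omega,J,g)$ one has $\tfrac12\,\omega\wedge\omega=-k\,e^1\wedge e^2\wedge e^3\wedge e^4$, and $J$ is integrable, so that the structure is Kähler. -/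

import Mathlib

namespace AlmostKahlerLie

open Module

noncomputable section

/-! ## Exterior calculus on a real Lie algebra -/

section Forms

variable {𝔤 : Type*} [LieRing 𝔤] [LieAlgebra ℝ 𝔤]

/-- The wedge product `α ∧ β` of two 1-forms: `(x, y) ↦ α x * β y - α y * β x`. -/
def wedge (α β : Dual ℝ 𝔤) : LinearMap.BilinForm ℝ 𝔤 :=
  LinearMap.mk₂ ℝ (fun x y => α x * β y - α y * β x)
    (fun _ _ _ => by simp; ring) (fun _ _ _ => by simp; ring)
    (fun _ _ _ => by simp; ring) (fun _ _ _ => by simp; ring)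

/-- The exterior (Chevalley–Eilenberg) derivative of a 1-form: `dα (x, y) = - α [x, y]`. -/
def extDeriv₁ (α : Dual ℝ 𝔤) : LinearMap.BilinForm ℝ 𝔤 :=
  LinearMap.mk₂ ℝ (fun x y => - α ⁅x, y⁆)
    (fun _ _ _ => by simp; ring) (fun _ _ _ => by simp)
    (fun _ _ _ => by simp; ring) (fun _ _ _ => by simp)

/-- The exterior (Chevalley–Eilenberg) derivative of a 2-form. -/
def extDeriv₂ (ω : LinearMap.BilinForm ℝ 𝔤) (x y z : 𝔤) : ℝ :=
  - ω ⁅x, y⁆ z + ω ⁅x, z⁆ y - ω ⁅y, z⁆ x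

/-- A 2-form is closed when its exterior derivative vanishes. -/
def IsClosedForm (ω : LinearMap.BilinForm ℝ 𝔤) : Prop :=
  ∀ x y z, extDeriv₂ ω x y z = 0

/-- The 4-form `ω ∧ ω / 2`, as the map
`(x, y) ↦ ((z, w) ↦ ω (x, y) ω (z, w) - ω (x, z) ω (y, w) + ω (x, w) ω (y, z))`. -/
def halfSquare (ω : LinearMap.BilinForm ℝ 𝔤) : 𝔤 →ₗ[ℝ] 𝔤 →ₗ[ℝ] LinearMap.BilinForm ℝ 𝔤 :=
  LinearMap.mk₂ ℝ (fun x y =>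
    LinearMap.mk₂ ℝ (fun z w => ω x y * ω z w - ω x z * ω y w + ω x w * ω y z)
      (fun _ _ _ => by simp; ring) (fun _ _ _ => by simp; ring)
      (fun _ _ _ => by simp; ring) (fun _ _ _ => by simp; ring))
    (fun _ _ _ => by ext; simp; ring) (fun _ _ _ => by ext; simp; ring)
    (fun _ _ _ => by ext; simp; ring) (fun _ _ _ => by ext; simp; ring)

/-- The Nijenhuis tensor of an endomorphism `J`. -/
def nijenhuis (J : End ℝ 𝔤) (x y : 𝔤) : 𝔤 :=
  ⁅J x, J y⁆ - J ⁅J x, y⁆ - J ⁅x, J y⁆ - ⁅x, y⁆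

end Forms

/-! ## Metrics and their curvature -/

/-- A (Riemannian) metric on a real vector space: a positive definite inner product.  On a Lie
algebra it is the same thing as a left-invariant Riemannian metric on a Lie group. -/
structure Metric (V : Type*) [AddCommGroup V] [Module ℝ V] where
  form : LinearMap.BilinForm ℝ V
  symm : ∀ x y, form x y = form y x
  pos : ∀ x, x ≠ 0 → 0 < form x x

theorem Metric.nondegenerate {V : Type*} [AddCommGroup V] [Module ℝ V] (g : Metric V) :
    g.form.Nondegenerate := by
  constructor
  · intro x hx
    by_contra h
    exact (g.pos x h).ne' (hx x)
  · intro x hx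
    by_contra h
    exact (g.pos x h).ne' (hx x)

section Curvature

variable {𝔤 : Type*} [LieRing 𝔤] [LieAlgebra ℝ 𝔤] [FiniteDimensional ℝ 𝔤]

/-- The musical isomorphism `♯`: `g (♯ α, y) = α y`. -/
def sharp (g : Metric 𝔤) : Dual ℝ 𝔤 →ₗ[ℝ] 𝔤 :=
  (g.form.toDual g.nondegenerate).symm.toLinearMap

theorem form_sharp (g : Metric 𝔤) (α : Dual ℝ 𝔤) (y : 𝔤) : g.form (sharp g α) y = α y :=
  LinearMap.BilinForm.apply_toDual_symm_apply (hB := g.nondegenerate) α y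

/-- The trace of a bilinear form with respect to the metric. -/
def metricTrace (g : Metric 𝔤) (B : LinearMap.BilinForm ℝ 𝔤) : ℝ :=
  LinearMap.trace ℝ 𝔤 (sharp g ∘ₗ B)

/-- The right-hand side of Koszul's formula for left-invariant vector fields,
`(g ([x, y], z) - g ([y, z], x) + g ([z, x], y)) / 2`, as a 1-form in `z`. -/
def koszul (g : Metric 𝔤) : 𝔤 →ₗ[ℝ] 𝔤 →ₗ[ℝ] Dual ℝ 𝔤 :=
  LinearMap.mk₂ ℝ (fun x y =>
    { toFun := fun z => (g.form ⁅x, y⁆ z - g.form ⁅y, z⁆ x + g.form ⁅z, x⁆ y) / 2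
      map_add' := fun _ _ => by simp; ring
      map_smul' := fun _ _ => by simp; ring })
    (fun _ _ _ => by ext; simp; ring) (fun _ _ _ => by ext; simp; ring)
    (fun _ _ _ => by ext; simp; ring) (fun _ _ _ => by ext; simp; ring)

/-- The Levi-Civita connection `x ↦ (y ↦ D_x y)` on left-invariant vector fields. -/
def leviCivita (g : Metric 𝔤) : 𝔤 →ₗ[ℝ] End ℝ 𝔤 :=
  (koszul g).compr₂ (sharp g)

theorem form_leviCivita (g : Metric 𝔤) (x y z : 𝔤) :
    g.form (leviCivita g x y) z =
      (g.form ⁅x, y⁆ z - g.form ⁅y, z⁆ x + g.form ⁅z, x⁆ y) / 2 :=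
  form_sharp g _ z

/-- The curvature `R_{x,y} = D_{[x,y]} - [D_x, D_y]`. -/
def curvature (g : Metric 𝔤) : 𝔤 →ₗ[ℝ] 𝔤 →ₗ[ℝ] End ℝ 𝔤 :=
  LinearMap.mk₂ ℝ
    (fun x y => leviCivita g ⁅x, y⁆ -
      (leviCivita g x * leviCivita g y - leviCivita g y * leviCivita g x))
    (fun _ _ _ => by simp [add_mul, mul_add]; abel)
    (fun _ _ _ => by simp [smul_sub])
    (fun _ _ _ => by simp [add_mul, mul_add]; abel)
    (fun _ _ _ => by simp [smul_sub])

/-- The curvature as a 4-tensor, `(x, y) ↦ ((z, w) ↦ g (R_{x,y} z, w))`; with the sign convention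
above, `g (R_{x,y} x, y)` is the sectional curvature of an orthonormal pair. -/
def curvatureTensor (g : Metric 𝔤) : 𝔤 →ₗ[ℝ] 𝔤 →ₗ[ℝ] LinearMap.BilinForm ℝ 𝔤 :=
  LinearMap.mk₂ ℝ (fun x y => g.form ∘ₗ curvature g x y)
    (fun _ _ _ => by ext; simp) (fun _ _ _ => by ext; simp)
    (fun _ _ _ => by ext; simp) (fun _ _ _ => by ext; simp)

/-- The Ricci tensor `(y, z) ↦ tr (x ↦ - R_{x,y} z)`. -/
def ricci (g : Metric 𝔤) : LinearMap.BilinForm ℝ 𝔤 :=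
  LinearMap.mk₂ ℝ (fun y z => - LinearMap.trace ℝ 𝔤 (((curvature g).flip y).flip z))
    (fun _ _ _ => by
      rw [← neg_add, ← map_add]; congr 2; ext; simp)
    (fun _ _ _ => by
      rw [smul_neg, ← map_smul]; congr 2; ext; simp)
    (fun _ _ _ => by
      rw [← neg_add, ← map_add]; congr 2; ext; simp)
    (fun _ _ _ => by
      rw [smul_neg, ← map_smul]; congr 2; ext; simp)

/-- The scalar curvature. -/
def scalarCurvature (g : Metric 𝔤) : ℝ := metricTrace g (ricci g)

/-- The Kulkarni–Nomizu product of two symmetric bilinear forms. -/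
def kulkarniNomizu (h k : LinearMap.BilinForm ℝ 𝔤) :
    𝔤 →ₗ[ℝ] 𝔤 →ₗ[ℝ] LinearMap.BilinForm ℝ 𝔤 :=
  LinearMap.mk₂ ℝ (fun x y =>
    LinearMap.mk₂ ℝ
      (fun z w => h x z * k y w + h y w * k x z - h x w * k y z - h y z * k x w)
      (fun _ _ _ => by simp; ring) (fun _ _ _ => by simp; ring)
      (fun _ _ _ => by simp; ring) (fun _ _ _ => by simp; ring))
    (fun _ _ _ => by ext; simp; ring) (fun _ _ _ => by ext; simp; ring)
    (fun _ _ _ => by ext; simp; ring) (fun _ _ _ => by ext; simp; ring)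

/-- The Weyl tensor in dimension 4: `W = R - (1/2) (Ric - (s/6) g) ∧ g`, where `∧` is the
Kulkarni–Nomizu product. -/
def weyl (g : Metric 𝔤) : 𝔤 →ₗ[ℝ] 𝔤 →ₗ[ℝ] LinearMap.BilinForm ℝ 𝔤 :=
  LinearMap.mk₂ ℝ (fun x y => curvatureTensor g x y -
      (1 / 2 : ℝ) • kulkarniNomizu (ricci g - (scalarCurvature g / 6) • g.form) g.form x y)
    (fun _ _ _ => by ext; simp; ring) (fun _ _ _ => by ext; simp; ring)
    (fun _ _ _ => by ext; simp; ring) (fun _ _ _ => by ext; simp; ring)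

/-- The inner product on 2-forms induced by the metric,
`(1/2) ∑ i j, α (f i, f j) * β (f i, f j)` in any orthonormal basis `f`
(so that the 2-forms `f i ∧ f j`, `i < j`, are orthonormal). -/
def formInner (g : Metric 𝔤) (α : LinearMap.BilinForm ℝ 𝔤) :
    LinearMap.BilinForm ℝ 𝔤 →ₗ[ℝ] ℝ where
  toFun β := (1 / 2 : ℝ) * LinearMap.trace ℝ 𝔤 ((sharp g ∘ₗ LinearMap.flip α) ∘ₗ (sharp g ∘ₗ β))
  map_add' β γ := by
    rw [LinearMap.comp_add, LinearMap.comp_add, map_add, mul_add]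
  map_smul' c β := by
    rw [LinearMap.comp_smul, LinearMap.comp_smul, map_smul, smul_eq_mul, smul_eq_mul,
      RingHom.id_apply, mul_left_comm]

/-- The operator on 2-forms defined by a 4-tensor `T`:
`α ↦ ((x, y) ↦ ⟨α, T (x, y, ·, ·)⟩)`. -/
def formOperator (g : Metric 𝔤) (T : 𝔤 →ₗ[ℝ] 𝔤 →ₗ[ℝ] LinearMap.BilinForm ℝ 𝔤)
    (α : LinearMap.BilinForm ℝ 𝔤) : LinearMap.BilinForm ℝ 𝔤 :=
  T.compr₂ (formInner g α)

/-- The Hodge star operator on 2-forms, for the metric `g` and the volume form `vol`. -/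
def hodgeStar (g : Metric 𝔤) (vol : 𝔤 →ₗ[ℝ] 𝔤 →ₗ[ℝ] LinearMap.BilinForm ℝ 𝔤)
    (α : LinearMap.BilinForm ℝ 𝔤) : LinearMap.BilinForm ℝ 𝔤 :=
  formOperator g vol α

/-- The self-dual part of a 2-form. -/
def selfDualPart (g : Metric 𝔤) (vol : 𝔤 →ₗ[ℝ] 𝔤 →ₗ[ℝ] LinearMap.BilinForm ℝ 𝔤)
    (α : LinearMap.BilinForm ℝ 𝔤) : LinearMap.BilinForm ℝ 𝔤 :=
  (1 / 2 : ℝ) • (α + hodgeStar g vol α)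

/-- The anti-self-dual part of a 2-form. -/
def antiSelfDualPart (g : Metric 𝔤) (vol : 𝔤 →ₗ[ℝ] 𝔤 →ₗ[ℝ] LinearMap.BilinForm ℝ 𝔤)
    (α : LinearMap.BilinForm ℝ 𝔤) : LinearMap.BilinForm ℝ 𝔤 :=
  (1 / 2 : ℝ) • (α - hodgeStar g vol α)

/-- The self-dual Weyl tensor `W⁺`: the self-dual block of the Weyl tensor, as an operator on
2-forms. -/
def weylPlus (g : Metric 𝔤) (vol : 𝔤 →ₗ[ℝ] 𝔤 →ₗ[ℝ] LinearMap.BilinForm ℝ 𝔤)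
    (α : LinearMap.BilinForm ℝ 𝔤) : LinearMap.BilinForm ℝ 𝔤 :=
  selfDualPart g vol (formOperator g (weyl g) (selfDualPart g vol α))

/-- The anti-self-dual Weyl tensor `W⁻`: the anti-self-dual block of the Weyl tensor, as an
operator on 2-forms. -/
def weylMinus (g : Metric 𝔤) (vol : 𝔤 →ₗ[ℝ] 𝔤 →ₗ[ℝ] LinearMap.BilinForm ℝ 𝔤)
    (α : LinearMap.BilinForm ℝ 𝔤) : LinearMap.BilinForm ℝ 𝔤 :=
  antiSelfDualPart g vol (formOperator g (weyl g) (antiSelfDualPart g vol α))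

/-- The metric is self-dual, for the orientation given by the volume form `vol`: `W⁻ = 0`. -/
def IsSelfDual (g : Metric 𝔤) (vol : 𝔤 →ₗ[ℝ] 𝔤 →ₗ[ℝ] LinearMap.BilinForm ℝ 𝔤) : Prop :=
  ∀ α : LinearMap.BilinForm ℝ 𝔤, α.IsAlt → weylMinus g vol α = 0

/-- The metric is conformally flat: `W⁺ = 0` and `W⁻ = 0`. -/
def IsConformallyFlat (g : Metric 𝔤)
    (vol : 𝔤 →ₗ[ℝ] 𝔤 →ₗ[ℝ] LinearMap.BilinForm ℝ 𝔤) : Prop :=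
  ∀ α : LinearMap.BilinForm ℝ 𝔤, α.IsAlt → weylPlus g vol α = 0 ∧ weylMinus g vol α = 0

end Curvature

/-! ## Almost-Kähler structures and the explicit model -/

section Structures

variable {𝔤 : Type*} [LieRing 𝔤] [LieAlgebra ℝ 𝔤]

/-- `(ω, J, g)` is an almost-Kähler structure on the Lie algebra: `J` is an almost complex
structure compatible with `g`, and `ω = g (J ·, ·)` is closed. (In dimension 4 the orientation
defined by `J` has `ω ∧ ω / 2` as its Riemannian volume form.) -/
structure IsAlmostKahler (ω : LinearMap.BilinForm ℝ 𝔤) (J : End ℝ 𝔤) (g : Metric 𝔤) :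
    Prop where
  sq : ∀ x, J (J x) = -x
  compatible : ∀ x y, g.form (J x) (J y) = g.form x y
  form_eq : ∀ x y, ω x y = g.form (J x) y
  closed : IsClosedForm ω

/-- An almost-Kähler structure is Kähler when `J` is integrable, i.e. its Nijenhuis tensor
vanishes. -/
structure IsKahler (ω : LinearMap.BilinForm ℝ 𝔤) (J : End ℝ 𝔤) (g : Metric 𝔤) : Prop
    extends IsAlmostKahler ω J g where
  integrable : ∀ x y, nijenhuis J x y = 0

/-- The De Smedt–Salamon model with parameters `lam`, `k`: the coframe `e¹, …, e⁴` dual to the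
basis `e 0, …, e 3` satisfies `de¹ = 0`, `de² = -e¹² - lam e¹³`, `de³ = lam e¹² - e¹³`,
`de⁴ = -2 e¹⁴ + e²³`, and `k⁻¹ e₁, e₂, e₃, e₄` is an orthonormal basis for `g`. -/
structure IsDeSmedtSalamonModel (g : Metric 𝔤) (lam k : ℝ) (e : Basis (Fin 4) ℝ 𝔤) :
    Prop where
  d_coord₀ : extDeriv₁ (e.coord 0) = 0
  d_coord₁ : extDeriv₁ (e.coord 1) =
    -wedge (e.coord 0) (e.coord 1) - lam • wedge (e.coord 0) (e.coord 2)
  d_coord₂ : extDeriv₁ (e.coord 2) =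
    lam • wedge (e.coord 0) (e.coord 1) - wedge (e.coord 0) (e.coord 2)
  d_coord₃ : extDeriv₁ (e.coord 3) =
    (-2 : ℝ) • wedge (e.coord 0) (e.coord 3) + wedge (e.coord 1) (e.coord 2)
  orthonormal : ∀ i j,
    g.form (![k⁻¹ • e 0, e 1, e 2, e 3] i) (![k⁻¹ • e 0, e 1, e 2, e 3] j) =
      if i = j then 1 else 0

end Structures

end

end AlmostKahlerLie

/-!
Let `(ω, J, g)` be an almost-Kähler structure on a Lie algebra `𝔤` of dimension 4.

*Reduction to matrices.* There is a unimodular ideal `𝔥` of codimension 1 (`exists_closed_form`).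
Let `f_0` be a unit normal of `𝔥` and put `e = J f_0`, a unit vector of `𝔥`. Then
`[f_0, y] = (S + Ω) y` with `S` symmetric and `Ω` skew, and `[y, z] = T (y × z)` with `T`
symmetric, because `𝔥` is unimodular (`×` is taken for the orientation of `𝔥` induced by `ω`). The
Jacobi identity is `ST + TS + [Ω, T] = tr S • T`, and `dω = 0` is `(T + S + Ω) e = tr S • e`. The
metric connection on anti-self-dual forms is given by `C = T - S` and `tr T` along `𝔥`, and by `Ω`
along `f_0`. Computing its curvature, one finds that `W⁻ = 0` if and only if
`2 C² - tr C • C + [Ω, C]` is a multiple of the identity (`dualBlock_semidirectConst`); the same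
holds for `W⁺`, with `S`, `Ω` replaced by `-S`, `-Ω`.

*Solution of the equations* (`SelfDualEquations.flatOrHyperbolic`). In an eigenbasis of `C` the
last condition says that `[Ω, C] = 0` and that `C` is either `x • 1` or `x • p` with `x ≠ 0` and
`p` an orthogonal projection of rank two. In the first case the Jacobi identity becomes
`(2 S - tr S) (S + x) = 0`, and either `W⁺ = 0` or `S` has the eigenvalues `-2x, -x, -x`, which is
incompatible with `dω = 0`. In the second case the Jacobi identity forces `S` to be block diagonal
(`entries_of_projection`), and either `W⁺ = 0` or `T = -2x • e eᵗ`, `S = -x • (1 + e eᵗ)` and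
`Ω e = 0`. This last Lie algebra is that of the complex hyperbolic plane, and there `J` is
integrable.

*The explicit model.* Its closed 2-forms are spanned by `e^{12}`, `e^{13}` and
`de^4 = -2 e^{14} + e^{23}`. The rows of the matrix of `J` in an orthonormal frame being unit
vectors, `ω = ± de^4` and `k = 2` (`IsDeSmedtSalamonModel.components`); conversely `± de^4` is
then compatible with `g`.
-/

namespace AlmostKahlerLie

open Module

/-! ### Curvature in an orthonormal frame -/

section Frames

variable {𝔤 : Type*} [LieRing 𝔤] [LieAlgebra ℝ 𝔤]

/-- The basis `f` is orthonormal for the metric `g`. -/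
def IsOrthonormalFrame {ι : Type*} [DecidableEq ι] (g : Metric 𝔤) (f : Basis ι ℝ 𝔤) : Prop :=
  ∀ i j, g.form (f i) (f j) = if i = j then 1 else 0

/-- The structure constants `c i j k = g ([f i, f j], f k)` of a Lie algebra in an orthonormal
frame `f`. -/
noncomputable def structConst {ι : Type*} (g : Metric 𝔤) (f : Basis ι ℝ 𝔤) (i j k : ι) : ℝ :=
  g.form ⁅f i, f j⁆ (f k)

/-- The Christoffel symbols `g (D_i f_j, f_k)` of a left-invariant metric whose structure
constants in an orthonormal frame are `c`. -/
noncomputable def christoffel {ι : Type*} (c : ι → ι → ι → ℝ) (i j k : ι) : ℝ :=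
  (c i j k - c j k i + c k i j) / 2

/-- The curvature components `g (R_{i,j} f_k, f_l)` of a left-invariant metric whose structure
constants in an orthonormal frame are `c`. -/
noncomputable def frameCurvature {ι : Type*} [Fintype ι] (c : ι → ι → ι → ℝ) (i j k l : ι) : ℝ :=
  ∑ m, (c i j m * christoffel c m k l -
    (christoffel c j k m * christoffel c i m l - christoffel c i k m * christoffel c j m l))

theorem Metric.ext_form (g : Metric 𝔤) {x y : 𝔤} (h : ∀ z, g.form x z = g.form y z) : x = y := by
  by_contra hne
  have h1 := g.pos (x - y) (sub_ne_zero.mpr hne)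
  have h2 := h (x - y)
  simp only [map_sub, LinearMap.sub_apply] at h1 h2
  linarith

theorem form_leviCivita_frame [FiniteDimensional ℝ 𝔤] {ι : Type*} {g : Metric 𝔤}
    {f : Basis ι ℝ 𝔤} (i j k : ι) :
    g.form (leviCivita g (f i) (f j)) (f k) = christoffel (structConst g f) i j k := by
  rw [form_leviCivita]; rfl

variable {ι : Type*} [Fintype ι] [DecidableEq ι] {g : Metric 𝔤} {f : Basis ι ℝ 𝔤}

theorem IsOrthonormalFrame.repr_eq (hf : IsOrthonormalFrame g f) (x : 𝔤) (i : ι) :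
    f.repr x i = g.form x (f i) := by
  conv_rhs => rw [← f.sum_repr x]
  simp only [map_sum, map_smul, LinearMap.sum_apply, LinearMap.smul_apply, hf _ i]
  simp

theorem IsOrthonormalFrame.sum_form_smul (hf : IsOrthonormalFrame g f) (x : 𝔤) :
    ∑ i, g.form x (f i) • f i = x := by
  simp_rw [← hf.repr_eq]
  exact f.sum_repr x

theorem IsOrthonormalFrame.form_eq_sum (hf : IsOrthonormalFrame g f) (x y : 𝔤) :
    g.form x y = ∑ i, g.form x (f i) * g.form y (f i) := by
  conv_lhs => rw [← hf.sum_form_smul y]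
  simp [mul_comm]

theorem IsOrthonormalFrame.ext (hf : IsOrthonormalFrame g f) {x y : 𝔤}
    (h : ∀ i, g.form x (f i) = g.form y (f i)) : x = y := by
  rw [← hf.sum_form_smul x, ← hf.sum_form_smul y]
  simp_rw [h]

theorem IsOrthonormalFrame.trace_eq (hf : IsOrthonormalFrame g f) (L : End ℝ 𝔤) :
    LinearMap.trace ℝ 𝔤 L = ∑ i, g.form (L (f i)) (f i) := by
  rw [LinearMap.trace_eq_matrix_trace ℝ f, Matrix.trace]
  simp [LinearMap.toMatrix_apply, hf.repr_eq]

variable [FiniteDimensional ℝ 𝔤]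

theorem IsOrthonormalFrame.metricTrace_eq (hf : IsOrthonormalFrame g f)
    (B : LinearMap.BilinForm ℝ 𝔤) : metricTrace g B = ∑ i, B (f i) (f i) := by
  rw [metricTrace, hf.trace_eq]
  simp [form_sharp]

theorem IsOrthonormalFrame.formInner_eq (hf : IsOrthonormalFrame g f)
    (α β : LinearMap.BilinForm ℝ 𝔤) :
    formInner g α β = (1 / 2) * ∑ i, ∑ j, α (f i) (f j) * β (f i) (f j) := by
  have h : formInner g α β = (1 / 2 : ℝ) *
    LinearMap.trace ℝ 𝔤 ((sharp g ∘ₗ LinearMap.flip α) ∘ₗ (sharp g ∘ₗ β)) := rfl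
  rw [h, hf.trace_eq]
  congr 1
  refine Finset.sum_congr rfl fun i _ => ?_
  simp only [LinearMap.comp_apply, form_sharp, LinearMap.flip_apply]
  rw [← hf.sum_form_smul (sharp g (β (f i)))]
  simp only [map_sum, map_smul, smul_eq_mul, form_sharp]
  exact Finset.sum_congr rfl fun j _ => mul_comm _ _

theorem IsOrthonormalFrame.form_leviCivita_left (hf : IsOrthonormalFrame g f) (x : 𝔤) (k l : ι) :
    g.form (leviCivita g x (f k)) (f l) =
      ∑ m, g.form x (f m) * christoffel (structConst g f) m k l := by
  conv_lhs => rw [← hf.sum_form_smul x]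
  simp [form_leviCivita_frame]

theorem IsOrthonormalFrame.form_leviCivita_right (hf : IsOrthonormalFrame g f) (i : ι) (x : 𝔤)
    (l : ι) :
    g.form (leviCivita g (f i) x) (f l) =
      ∑ m, g.form x (f m) * christoffel (structConst g f) i m l := by
  conv_lhs => rw [← hf.sum_form_smul x]
  simp [form_leviCivita_frame]

theorem IsOrthonormalFrame.curvatureTensor_eq (hf : IsOrthonormalFrame g f) (i j k l : ι) :
    curvatureTensor g (f i) (f j) (f k) (f l) = frameCurvature (structConst g f) i j k l := by
  have h : curvatureTensor g (f i) (f j) (f k) (f l) =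
      g.form ((leviCivita g ⁅f i, f j⁆ - (leviCivita g (f i) * leviCivita g (f j) -
        leviCivita g (f j) * leviCivita g (f i))) (f k)) (f l) := rfl
  rw [h, frameCurvature]
  simp only [LinearMap.sub_apply, map_sub, Module.End.mul_apply, Finset.sum_sub_distrib,
    hf.form_leviCivita_left ⁅f i, f j⁆, hf.form_leviCivita_right _ (leviCivita g _ _),
    form_leviCivita_frame]
  rfl

theorem IsOrthonormalFrame.ricci_eq (hf : IsOrthonormalFrame g f) (y z : 𝔤) :
    ricci g y z = - ∑ i, curvatureTensor g (f i) y z (f i) := by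
  have h : ricci g y z = - LinearMap.trace ℝ 𝔤 (((curvature g).flip y).flip z) := rfl
  rw [h, hf.trace_eq]
  rfl

end Frames

section Symmetries

variable {𝔤 : Type*} [LieRing 𝔤] [LieAlgebra ℝ 𝔤] [FiniteDimensional ℝ 𝔤] (g : Metric 𝔤)

theorem leviCivita_metric (x y z : 𝔤) :
    g.form (leviCivita g x y) z = - g.form (leviCivita g x z) y := by
  rw [form_leviCivita, form_leviCivita, ← lie_skew z y, ← lie_skew x z, ← lie_skew y x]
  simp only [map_neg, LinearMap.neg_apply]
  ring

theorem leviCivita_torsionFree (x y : 𝔤) : leviCivita g x y - leviCivita g y x = ⁅x, y⁆ := by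
  refine g.ext_form fun z => ?_
  rw [map_sub, LinearMap.sub_apply, form_leviCivita, form_leviCivita, ← lie_skew z y,
    ← lie_skew x z, ← lie_skew y x]
  simp only [map_neg, LinearMap.neg_apply]
  ring

theorem curvatureTensor_apply (x y z w : 𝔤) :
    curvatureTensor g x y z w = g.form (leviCivita g ⁅x, y⁆ z) w -
      (g.form (leviCivita g x (leviCivita g y z)) w -
        g.form (leviCivita g y (leviCivita g x z)) w) := by
  have h : curvatureTensor g x y z w =
      g.form ((leviCivita g ⁅x, y⁆ - (leviCivita g x * leviCivita g y -
        leviCivita g y * leviCivita g x)) z) w := rfl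
  rw [h]
  simp only [LinearMap.sub_apply, map_sub, Module.End.mul_apply]

theorem curvatureTensor_swap_left (x y z w : 𝔤) :
    curvatureTensor g y x z w = - curvatureTensor g x y z w := by
  rw [curvatureTensor_apply, curvatureTensor_apply, ← lie_skew x y]
  simp only [map_neg, LinearMap.neg_apply]
  ring

theorem curvatureTensor_swap_right (x y z w : 𝔤) :
    curvatureTensor g x y w z = - curvatureTensor g x y z w := by
  rw [curvatureTensor_apply, curvatureTensor_apply, leviCivita_metric g ⁅x, y⁆ w z,
    leviCivita_metric g x (leviCivita g y w) z, leviCivita_metric g y (leviCivita g x w) z,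
    leviCivita_metric g y (leviCivita g x z) w, leviCivita_metric g x (leviCivita g y z) w,
    g.symm (leviCivita g x z), g.symm (leviCivita g y z)]
  ring

/-- The first Bianchi identity. -/
theorem curvatureTensor_bianchi (x y z w : 𝔤) :
    curvatureTensor g x y z w + curvatureTensor g y z x w + curvatureTensor g z x y w = 0 := by
  have hJ : ⁅x, ⁅y, z⁆⁆ + ⁅y, ⁅z, x⁆⁆ + ⁅z, ⁅x, y⁆⁆ = 0 := lie_jacobi x y z
  have key : ∀ a b c : 𝔤, leviCivita g a (leviCivita g b c) - leviCivita g a (leviCivita g c b)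
      = leviCivita g ⁅b, c⁆ a + ⁅a, ⁅b, c⁆⁆ := fun a b c => by
    rw [← map_sub, leviCivita_torsionFree, ← leviCivita_torsionFree g a ⁅b, c⁆]
    abel
  have h := congrArg (fun v => g.form v w) hJ
  have h1 := congrArg (fun v => g.form v w) (key x y z)
  have h2 := congrArg (fun v => g.form v w) (key y z x)
  have h3 := congrArg (fun v => g.form v w) (key z x y)
  simp only [map_add, map_sub, LinearMap.add_apply, LinearMap.sub_apply, map_zero,
    LinearMap.zero_apply] at h h1 h2 h3
  simp only [curvatureTensor_apply]
  linarith

theorem curvatureTensor_pair_symm (x y z w : 𝔤) :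
    curvatureTensor g z w x y = curvatureTensor g x y z w := by
  have b1 := curvatureTensor_bianchi g x y z w
  have b2 := curvatureTensor_bianchi g y z w x
  have b3 := curvatureTensor_bianchi g z w x y
  have b4 := curvatureTensor_bianchi g w x y z
  have l := curvatureTensor_swap_left g
  have r := curvatureTensor_swap_right g
  linarith [r y z w x, r z w x y, r w y z x, r z x w y, r x z w y, l x z w y, l y w x z,
    l x z y w, r y w x z, r w y x z, r x y z w, l y w z x, r w x y z, l z x y w, r z x y w,
    l w y x z, r x z y w]

end Symmetries

/-! ### The Weyl tensor on self-dual and anti-self-dual forms -/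

section Blocks

/-- The indices `(i, j)` of the three coordinate planes `f_0 ∧ f_{a+1}`. -/
def planeIndex (a : Fin 3) : Fin 4 × Fin 4 := ![(0, 1), (0, 2), (0, 3)] a

/-- The indices `(i, j)` of the positively oriented orthogonal complements `f_{a+2} ∧ f_{a+3}` of
the three coordinate planes `f_0 ∧ f_{a+1}`. -/
def coplaneIndex (a : Fin 3) : Fin 4 × Fin 4 := ![(2, 3), (3, 1), (1, 2)] a

/-- The matrix of a 4-tensor with frame components `R`, as a bilinear form on 2-forms, in the basis
`f^{0a} + σ f^{bc}`, `(a, b, c)` a cyclic permutation of `(1, 2, 3)`.  For `σ = 1` this is the block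
on self-dual forms, for `σ = -1` the one on anti-self-dual forms. -/
def dualBlock (R : Fin 4 → Fin 4 → Fin 4 → Fin 4 → ℝ) (σ : ℝ) (a b : Fin 3) : ℝ :=
  R (planeIndex a).1 (planeIndex a).2 (planeIndex b).1 (planeIndex b).2 +
    σ * R (planeIndex a).1 (planeIndex a).2 (coplaneIndex b).1 (coplaneIndex b).2 +
    σ * R (coplaneIndex a).1 (coplaneIndex a).2 (planeIndex b).1 (planeIndex b).2 +
    R (coplaneIndex a).1 (coplaneIndex a).2 (coplaneIndex b).1 (coplaneIndex b).2

/-- The matrix `M` is a multiple of the identity. -/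
def IsScalarBlock (M : Fin 3 → Fin 3 → ℝ) : Prop :=
  ∃ c : ℝ, ∀ a b, M a b = if a = b then c else 0

/-- The components of the Kähler form `f^{01} + f^{23}`. -/
def kahlerComponents : Matrix (Fin 4) (Fin 4) ℝ :=
  !![0, 1, 0, 0; -1, 0, 0, 0; 0, 0, 0, 1; 0, 0, -1, 0]

variable {𝔤 : Type*} [LieRing 𝔤] [LieAlgebra ℝ 𝔤] {g : Metric 𝔤} {f : Basis (Fin 4) ℝ 𝔤}

theorem isAlt_eq_zero {B : LinearMap.BilinForm ℝ 𝔤} (hB : B.IsAlt)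
    (hp : ∀ a, B (f (planeIndex a).1) (f (planeIndex a).2) = 0)
    (hq : ∀ a, B (f (coplaneIndex a).1) (f (coplaneIndex a).2) = 0) : B = 0 := by
  have hn : ∀ x y, B x y = 0 → B y x = 0 := fun x y h => by rw [← hB.neg_eq x y, h, neg_zero]
  have p0 := hp 0
  have p1 := hp 1
  have p2 := hp 2
  have q0 := hq 0
  have q1 := hq 1
  have q2 := hq 2
  simp only [planeIndex, coplaneIndex, Matrix.cons_val] at p0 p1 p2 q0 q1 q2
  refine f.ext fun i => f.ext fun j => ?_
  fin_cases i <;> fin_cases j <;> first | exact hB _ | assumption | (apply hn; assumption)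

theorem isAlt_of_neg {B : LinearMap.BilinForm ℝ 𝔤} (h : ∀ x y, B y x = - B x y) : B.IsAlt :=
  fun x => by linarith [h x x]

theorem halfSquare_apply (ω : LinearMap.BilinForm ℝ 𝔤) (x y z w : 𝔤) :
    halfSquare ω x y z w = ω x y * ω z w - ω x z * ω y w + ω x w * ω y z := rfl

variable {ω : LinearMap.BilinForm ℝ 𝔤}

theorem halfSquare_swap (hω : ω.IsAlt) (x y : 𝔤) : halfSquare ω y x = - halfSquare ω x y := by
  ext z w
  simp only [LinearMap.neg_apply, halfSquare_apply, ← hω.neg_eq x y]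
  ring

theorem halfSquare_isAlt (hω : ω.IsAlt) (x y : 𝔤) :
    LinearMap.BilinForm.IsAlt (halfSquare ω x y) := by
  refine isAlt_of_neg fun z w => ?_
  simp only [halfSquare_apply, ← hω.neg_eq z w]
  ring

theorem isAlt_of_kahlerComponents (hc : ∀ i j, ω (f i) (f j) = kahlerComponents i j) :
    ω.IsAlt := by
  have h : LinearMap.flip ω = -ω := by
    refine f.ext fun i => f.ext fun j => ?_
    rw [LinearMap.flip_apply, LinearMap.neg_apply, LinearMap.neg_apply, hc, hc]
    fin_cases i <;> fin_cases j <;> simp [kahlerComponents]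
  exact isAlt_of_neg fun x y => by rw [← LinearMap.flip_apply, h]; rfl

variable [FiniteDimensional ℝ 𝔤]

theorem formOperator_apply (T : 𝔤 →ₗ[ℝ] 𝔤 →ₗ[ℝ] LinearMap.BilinForm ℝ 𝔤)
    (α : LinearMap.BilinForm ℝ 𝔤) (x y : 𝔤) :
    formOperator g T α x y = formInner g α (T x y) := rfl

theorem formOperator_isAlt {T : 𝔤 →ₗ[ℝ] 𝔤 →ₗ[ℝ] LinearMap.BilinForm ℝ 𝔤}
    (hT : ∀ x y, T y x = - T x y) (α : LinearMap.BilinForm ℝ 𝔤) :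
    (formOperator g T α).IsAlt :=
  isAlt_of_neg fun x y => by 
    rw [formOperator_apply, formOperator_apply, hT]
    exact map_neg (formInner g α) (T x y)

theorem selfDualPart_apply (vol : 𝔤 →ₗ[ℝ] 𝔤 →ₗ[ℝ] LinearMap.BilinForm ℝ 𝔤)
    (α : LinearMap.BilinForm ℝ 𝔤) (x y : 𝔤) :
    selfDualPart g vol α x y = (1 / 2) * (α x y + hodgeStar g vol α x y) := rfl

theorem antiSelfDualPart_apply (vol : 𝔤 →ₗ[ℝ] 𝔤 →ₗ[ℝ] LinearMap.BilinForm ℝ 𝔤)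
    (α : LinearMap.BilinForm ℝ 𝔤) (x y : 𝔤) :
    antiSelfDualPart g vol α x y = (1 / 2) * (α x y - hodgeStar g vol α x y) := rfl

/-- In an orthonormal frame, the inner product with an alternating form is a sum over the six
coordinate planes. -/
theorem IsOrthonormalFrame.formInner_eq_planes (hf : IsOrthonormalFrame g f)
    {α β : LinearMap.BilinForm ℝ 𝔤} (hα : α.IsAlt) (hβ : β.IsAlt) :
    formInner g α β =
      ∑ a, (α (f (planeIndex a).1) (f (planeIndex a).2) *
          β (f (planeIndex a).1) (f (planeIndex a).2) +
        α (f (coplaneIndex a).1) (f (coplaneIndex a).2) *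
          β (f (coplaneIndex a).1) (f (coplaneIndex a).2)) := by
  rw [hf.formInner_eq]
  simp only [Fin.sum_univ_four, Fin.sum_univ_three, planeIndex, coplaneIndex, Matrix.cons_val,
    hα (f _), hβ (f _), ← hα.neg_eq (f 0) (f 1), ← hα.neg_eq (f 0) (f 2), ← hα.neg_eq (f 0) (f 3),
    ← hα.neg_eq (f 1) (f 2), ← hα.neg_eq (f 3) (f 1), ← hα.neg_eq (f 2) (f 3),
    ← hβ.neg_eq (f 0) (f 1), ← hβ.neg_eq (f 0) (f 2), ← hβ.neg_eq (f 0) (f 3),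
    ← hβ.neg_eq (f 1) (f 2), ← hβ.neg_eq (f 3) (f 1), ← hβ.neg_eq (f 2) (f 3)]
  ring

section Hodge

theorem hodgeStar_isAlt (hω : ω.IsAlt) (α : LinearMap.BilinForm ℝ 𝔤) :
    (hodgeStar g (halfSquare ω) α).IsAlt :=
  formOperator_isAlt (halfSquare_swap hω) α

/-- The Hodge star of the volume form `ω ∧ ω / 2` exchanges the planes `f_0 ∧ f_a` with their
orthogonal complements. -/
theorem IsOrthonormalFrame.hodgeStar_plane (hf : IsOrthonormalFrame g f)
    (hc : ∀ i j, ω (f i) (f j) = kahlerComponents i j) {α : LinearMap.BilinForm ℝ 𝔤}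
    (hα : α.IsAlt) (a : Fin 3) :
    hodgeStar g (halfSquare ω) α (f (planeIndex a).1) (f (planeIndex a).2) =
      α (f (coplaneIndex a).1) (f (coplaneIndex a).2) ∧
    hodgeStar g (halfSquare ω) α (f (coplaneIndex a).1) (f (coplaneIndex a).2) =
      α (f (planeIndex a).1) (f (planeIndex a).2) := by
  have hω := isAlt_of_kahlerComponents hc
  rw [hodgeStar, formOperator_apply, formOperator_apply,
    hf.formInner_eq_planes hα (halfSquare_isAlt hω _ _),
    hf.formInner_eq_planes hα (halfSquare_isAlt hω _ _)]
  simp only [Fin.sum_univ_three, halfSquare_apply, hc]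
  fin_cases a <;> simp [planeIndex, coplaneIndex, kahlerComponents]

/-- On an alternating form, `W⁻` acts through the anti-self-dual block of the Weyl tensor. -/
theorem IsOrthonormalFrame.weylMinus_plane (hf : IsOrthonormalFrame g f)
    (hc : ∀ i j, ω (f i) (f j) = kahlerComponents i j)
    (hW₁ : ∀ x y, weyl g y x = - weyl g x y)
    (hW₂ : ∀ x y, LinearMap.BilinForm.IsAlt (weyl g x y))
    {α : LinearMap.BilinForm ℝ 𝔤} (hα : α.IsAlt) (a : Fin 3) :
    weylMinus g (halfSquare ω) α (f (planeIndex a).1) (f (planeIndex a).2) =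
      (1 / 4) * ∑ b, dualBlock (fun i j k l => weyl g (f i) (f j) (f k) (f l)) (-1) a b *
        (α (f (planeIndex b).1) (f (planeIndex b).2) -
          α (f (coplaneIndex b).1) (f (coplaneIndex b).2)) := by
  have hω := isAlt_of_kahlerComponents hc
  have hβ : (antiSelfDualPart g (halfSquare ω) α).IsAlt := fun x => by
    rw [antiSelfDualPart_apply, hα x, hodgeStar_isAlt hω α x]; ring
  rw [weylMinus, antiSelfDualPart_apply, (hf.hodgeStar_plane hc (formOperator_isAlt hW₁ _) a).1,
    formOperator_apply, formOperator_apply, hf.formInner_eq_planes hβ (hW₂ _ _),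
    hf.formInner_eq_planes hβ (hW₂ _ _), ← Finset.sum_sub_distrib, Finset.mul_sum, Finset.mul_sum]
  refine Finset.sum_congr rfl fun b _ => ?_
  simp only [antiSelfDualPart_apply, (hf.hodgeStar_plane hc hα b).1,
    (hf.hodgeStar_plane hc hα b).2, dualBlock]
  ring

/-- On an alternating form, `W⁺` acts through the self-dual block of the Weyl tensor. -/
theorem IsOrthonormalFrame.weylPlus_plane (hf : IsOrthonormalFrame g f)
    (hc : ∀ i j, ω (f i) (f j) = kahlerComponents i j)
    (hW₁ : ∀ x y, weyl g y x = - weyl g x y)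
    (hW₂ : ∀ x y, LinearMap.BilinForm.IsAlt (weyl g x y))
    {α : LinearMap.BilinForm ℝ 𝔤} (hα : α.IsAlt) (a : Fin 3) :
    weylPlus g (halfSquare ω) α (f (planeIndex a).1) (f (planeIndex a).2) =
      (1 / 4) * ∑ b, dualBlock (fun i j k l => weyl g (f i) (f j) (f k) (f l)) 1 a b *
        (α (f (planeIndex b).1) (f (planeIndex b).2) +
          α (f (coplaneIndex b).1) (f (coplaneIndex b).2)) ∧
    weylPlus g (halfSquare ω) α (f (coplaneIndex a).1) (f (coplaneIndex a).2) =
      weylPlus g (halfSquare ω) α (f (planeIndex a).1) (f (planeIndex a).2) := by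
  have hω := isAlt_of_kahlerComponents hc
  have hβ : (selfDualPart g (halfSquare ω) α).IsAlt := fun x => by
    rw [selfDualPart_apply, hα x, hodgeStar_isAlt hω α x]; ring
  have hs := hf.hodgeStar_plane hc
    (formOperator_isAlt (g := g) hW₁ (selfDualPart g (halfSquare ω) α)) a
  rw [weylPlus, selfDualPart_apply, selfDualPart_apply, hs.1, hs.2]
  refine ⟨?_, by ring⟩
  rw [formOperator_apply, formOperator_apply, hf.formInner_eq_planes hβ (hW₂ _ _),
    hf.formInner_eq_planes hβ (hW₂ _ _), ← Finset.sum_add_distrib, Finset.mul_sum, Finset.mul_sum]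
  refine Finset.sum_congr rfl fun b _ => ?_
  simp only [selfDualPart_apply, (hf.hodgeStar_plane hc hα b).1,
    (hf.hodgeStar_plane hc hα b).2, dualBlock]
  ring

end Hodge

section Weyl

theorem weyl_apply (x y z w : 𝔤) :
    weyl g x y z w = curvatureTensor g x y z w - (1 / 2) *
      ((ricci g x z - scalarCurvature g / 6 * g.form x z) * g.form y w +
        (ricci g y w - scalarCurvature g / 6 * g.form y w) * g.form x z -
        (ricci g x w - scalarCurvature g / 6 * g.form x w) * g.form y z -
        (ricci g y z - scalarCurvature g / 6 * g.form y z) * g.form x w) := rfl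

theorem weyl_swap_left (x y : 𝔤) : weyl g y x = - weyl g x y := by
  ext z w
  rw [LinearMap.neg_apply, LinearMap.neg_apply, weyl_apply, weyl_apply,
    curvatureTensor_swap_left g x y]
  ring

theorem weyl_isAlt (x y : 𝔤) : LinearMap.BilinForm.IsAlt (weyl g x y) := by
  refine isAlt_of_neg fun z w => ?_
  rw [weyl_apply, weyl_apply, curvatureTensor_swap_right g x y z w]
  ring

theorem IsOrthonormalFrame.ricci_symm (hf : IsOrthonormalFrame g f) (x y : 𝔤) :
    ricci g x y = ricci g y x := by
  rw [hf.ricci_eq, hf.ricci_eq]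
  congr 1
  refine Finset.sum_congr rfl fun i _ => ?_
  rw [curvatureTensor_pair_symm g y (f i) (f i) x, curvatureTensor_swap_left,
    curvatureTensor_swap_right, neg_neg]

/-- The trace-free Ricci tensor exchanges self-dual and anti-self-dual forms, so that on each of the
two diagonal blocks the Weyl tensor differs from the curvature by a multiple of the identity. -/
theorem IsOrthonormalFrame.dualBlock_weyl (hf : IsOrthonormalFrame g f) {σ : ℝ}
    (hσ : σ = 1 ∨ σ = -1) (a b : Fin 3) :
    dualBlock (fun i j k l => weyl g (f i) (f j) (f k) (f l)) σ a b =
      dualBlock (fun i j k l => curvatureTensor g (f i) (f j) (f k) (f l)) σ a b -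
        if a = b then scalarCurvature g / 6 else 0 := by
  have hs : scalarCurvature g = ∑ i, ricci g (f i) (f i) := hf.metricTrace_eq _
  have r01 := hf.ricci_symm (f 0) (f 1)
  have r02 := hf.ricci_symm (f 0) (f 2)
  have r03 := hf.ricci_symm (f 0) (f 3)
  have r12 := hf.ricci_symm (f 1) (f 2)
  have r13 := hf.ricci_symm (f 1) (f 3)
  have r23 := hf.ricci_symm (f 2) (f 3)
  rw [Fin.sum_univ_four] at hs
  simp only [dualBlock, weyl_apply, hf _ _]
  rcases hσ with rfl | rfl <;> fin_cases a <;> fin_cases b <;>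
    simp [planeIndex, coplaneIndex] <;> linarith

/-- The trace of either diagonal block of the curvature; the contribution of the mixed components
vanishes by the first Bianchi identity. -/
theorem IsOrthonormalFrame.sum_dualBlock_curvature (hf : IsOrthonormalFrame g f) {σ : ℝ}
    (hσ : σ = 1 ∨ σ = -1) :
    ∑ a, dualBlock (fun i j k l => curvatureTensor g (f i) (f j) (f k) (f l)) σ a a =
      scalarCurvature g / 2 := by
  have hs : scalarCurvature g = ∑ i, ricci g (f i) (f i) := hf.metricTrace_eq _
  have hz : ∀ i j k, curvatureTensor g (f i) (f i) (f j) (f k) = 0 := fun i j k => by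
    linarith [curvatureTensor_swap_left g (f i) (f i) (f j) (f k)]
  have b := curvatureTensor_bianchi g (f 2) (f 3) (f 1) (f 0)
  have l := curvatureTensor_swap_left g
  have r := curvatureTensor_swap_right g
  have p := curvatureTensor_pair_symm g
  simp only [Fin.sum_univ_four, hf.ricci_eq, hz] at hs
  simp only [dualBlock, Fin.sum_univ_three, planeIndex, coplaneIndex, Matrix.cons_val]
  rcases hσ with rfl | rfl <;>
  linarith [l (f 0) (f 1) (f 1) (f 0), r (f 0) (f 1) (f 0) (f 1), r (f 1) (f 0) (f 0) (f 1),
    l (f 0) (f 1) (f 0) (f 1),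
    l (f 0) (f 2) (f 0) (f 2), r (f 0) (f 2) (f 0) (f 2), r (f 2) (f 0) (f 0) (f 2),
    l (f 0) (f 3) (f 0) (f 3), r (f 0) (f 3) (f 0) (f 3), r (f 3) (f 0) (f 0) (f 3),
    l (f 1) (f 2) (f 1) (f 2), r (f 1) (f 2) (f 1) (f 2), r (f 2) (f 1) (f 1) (f 2),
    l (f 3) (f 1) (f 3) (f 1), r (f 3) (f 1) (f 3) (f 1), r (f 1) (f 3) (f 3) (f 1),
    l (f 2) (f 3) (f 2) (f 3), r (f 2) (f 3) (f 2) (f 3), r (f 3) (f 2) (f 2) (f 3),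
    p (f 0) (f 1) (f 2) (f 3), p (f 0) (f 2) (f 3) (f 1), p (f 0) (f 3) (f 1) (f 2),
    r (f 2) (f 3) (f 1) (f 0), r (f 3) (f 1) (f 2) (f 0), r (f 1) (f 2) (f 3) (f 0)]

theorem isScalarBlock_curvature_of_isSelfDual (hf : IsOrthonormalFrame g f)
    {ω : LinearMap.BilinForm ℝ 𝔤} (hc : ∀ i j, ω (f i) (f j) = kahlerComponents i j)
    (h : IsSelfDual g (halfSquare ω)) :
    IsScalarBlock (dualBlock (frameCurvature (structConst g f)) (-1)) := by
  refine ⟨scalarCurvature g / 6, fun a b => ?_⟩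
  have hα : (wedge (f.coord (planeIndex b).1) (f.coord (planeIndex b).2)).IsAlt := fun x => by
    simp [wedge, mul_comm]
  have h0 := hf.weylMinus_plane hc weyl_swap_left weyl_isAlt hα a
  rw [h _ hα] at h0
  have h1 : dualBlock (fun i j k l => weyl g (f i) (f j) (f k) (f l)) (-1) a b = 0 := by
    revert h0
    fin_cases b <;> simp [planeIndex, coplaneIndex, Fin.sum_univ_three, wedge, Finsupp.single_apply]
  rw [hf.dualBlock_weyl (Or.inr rfl)] at h1
  simp only [hf.curvatureTensor_eq] at h1
  exact sub_eq_zero.mp h1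

theorem weylPlus_eq_zero_of_isScalarBlock (hf : IsOrthonormalFrame g f)
    {ω : LinearMap.BilinForm ℝ 𝔤} (hc : ∀ i j, ω (f i) (f j) = kahlerComponents i j)
    (h : IsScalarBlock (dualBlock (frameCurvature (structConst g f)) 1))
    {α : LinearMap.BilinForm ℝ 𝔤} (hα : α.IsAlt) :
    weylPlus g (halfSquare ω) α = 0 := by
  obtain ⟨c, hM⟩ := h
  have hω := isAlt_of_kahlerComponents hc
  have hsum := hf.sum_dualBlock_curvature (σ := 1) (Or.inl rfl)
  simp only [hf.curvatureTensor_eq] at hsum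
  have hscal : 3 * c = scalarCurvature g / 2 := by
    rw [← hsum, Fin.sum_univ_three]
    change 3 * c = dualBlock (frameCurvature (structConst g f)) 1 0 0 +
      dualBlock (frameCurvature (structConst g f)) 1 1 1 +
      dualBlock (frameCurvature (structConst g f)) 1 2 2
    simp only [hM, if_true]
    ring
  have h0 : ∀ a b, dualBlock (fun i j k l => weyl g (f i) (f j) (f k) (f l)) 1 a b = 0 := by
    intro a b
    rw [hf.dualBlock_weyl (Or.inl rfl)]
    simp only [hf.curvatureTensor_eq]
    change dualBlock (frameCurvature (structConst g f)) 1 a b - _ = 0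
    rw [hM]
    split_ifs <;> linarith
  have hp : ∀ a, weylPlus g (halfSquare ω) α (f (planeIndex a).1) (f (planeIndex a).2) = 0 := by
    intro a
    rw [(hf.weylPlus_plane hc weyl_swap_left weyl_isAlt hα a).1]
    simp [h0]
  refine isAlt_eq_zero (f := f) ?_ hp fun a => ?_
  · intro x
    rw [weylPlus, selfDualPart_apply, formOperator_isAlt weyl_swap_left _ x, hodgeStar_isAlt hω _ x]
    ring
  · rw [(hf.weylPlus_plane hc weyl_swap_left weyl_isAlt hα a).2, hp]

end Weyl

end Blocks

/-! ### Curvature of a semidirect product -/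

section Semidirect

/-- The structure constants, in a frame `f_0, f_1, f_2, f_3`, of a Lie algebra in which
`f_1, f_2, f_3` span an ideal, `ad f_0` acts on this ideal by the matrix `A`, and the bracket of
the ideal is `[y, z] = T (y × z)`. -/
def semidirectConst (A T : Matrix (Fin 3) (Fin 3) ℝ) : Fin 4 → Fin 4 → Fin 4 → ℝ :=
  ![![0, ![0, A 0 0, A 1 0, A 2 0], ![0, A 0 1, A 1 1, A 2 1], ![0, A 0 2, A 1 2, A 2 2]],
    ![![0, -A 0 0, -A 1 0, -A 2 0], 0, ![0, T 0 2, T 1 2, T 2 2], ![0, -T 0 1, -T 1 1, -T 2 1]],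
    ![![0, -A 0 1, -A 1 1, -A 2 1], ![0, -T 0 2, -T 1 2, -T 2 2], 0, ![0, T 0 0, T 1 0, T 2 0]],
    ![![0, -A 0 2, -A 1 2, -A 2 2], ![0, T 0 1, T 1 1, T 2 1], ![0, -T 0 0, -T 1 0, -T 2 0], 0]]

/-- The quadratic expression `2 C² - tr C • C + [Ω, C]`.  Up to sign and a multiple of the identity,
it is the curvature on self-dual or anti-self-dual forms: see `dualBlock_semidirectConst`. -/
noncomputable def weylMatrix (Ω C : Matrix (Fin 3) (Fin 3) ℝ) : Matrix (Fin 3) (Fin 3) ℝ :=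
  (2 : ℝ) • (C * C) - C.trace • C + (Ω * C - C * Ω)

theorem apply_swap_of_skew {Ω : Matrix (Fin 3) (Fin 3) ℝ} (h : Ω.transpose = -Ω) (i j : Fin 3) :
    Ω j i = -Ω i j := congrFun (congrFun h i) j

theorem apply_self_of_skew {Ω : Matrix (Fin 3) (Fin 3) ℝ} (h : Ω.transpose = -Ω) (i : Fin 3) :
    Ω i i = 0 := self_eq_neg.mp (apply_swap_of_skew h i i)

set_option maxHeartbeats 1000000 in
/-- On a semidirect product, the curvature on forms of duality `σ` involves the symmetric data `S`,
`T` only through `C = T + σ S`, up to a multiple of the identity: the metric connection on these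
forms is given by `C` and `tr T` along the ideal, and by `Ω` along `f_0`. -/
theorem dualBlock_semidirectConst {S T Ω : Matrix (Fin 3) (Fin 3) ℝ} (hS : S.transpose = S)
    (hT : T.transpose = T) (hΩ : Ω.transpose = -Ω) {σ : ℝ} (hσ : σ = 1 ∨ σ = -1) :
    ∃ q : ℝ, ∀ a b, dualBlock (frameCurvature (semidirectConst (S + Ω) T)) σ a b =
      - weylMatrix (-σ • Ω) (T + σ • S) a b + if a = b then q else 0 := by
  have s10 : S 1 0 = S 0 1 := congrFun (congrFun hS 0) 1
  have s20 : S 2 0 = S 0 2 := congrFun (congrFun hS 0) 2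
  have s21 : S 2 1 = S 1 2 := congrFun (congrFun hS 1) 2
  have t10 : T 1 0 = T 0 1 := congrFun (congrFun hT 0) 1
  have t20 : T 2 0 = T 0 2 := congrFun (congrFun hT 0) 2
  have t21 : T 2 1 = T 1 2 := congrFun (congrFun hT 1) 2
  have o10 := apply_swap_of_skew hΩ 0 1
  have o20 := apply_swap_of_skew hΩ 0 2
  have o21 := apply_swap_of_skew hΩ 1 2
  have o00 := apply_self_of_skew hΩ 0
  have o11 := apply_self_of_skew hΩ 1
  have o22 := apply_self_of_skew hΩ 2
  refine ⟨dualBlock (frameCurvature (semidirectConst (S + Ω) T)) σ 0 0 +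
    weylMatrix (-σ • Ω) (T + σ • S) 0 0, fun a b => ?_⟩
  -- both sides are polynomial in `σ`, and agree modulo `σ ^ 2 = 1`
  have hσ2 : σ ^ 2 = 1 := by rcases hσ with rfl | rfl <;> norm_num
  fin_cases a <;> fin_cases b <;>
    simp [dualBlock, planeIndex, coplaneIndex, frameCurvature, christoffel, semidirectConst,
      Fin.sum_univ_four, weylMatrix, Matrix.mul_apply, Fin.sum_univ_three, Matrix.trace,
      s10, s20, s21, t10, t20, t21, o10, o20, o21, o00, o11, o22] <;>
    ring_nf <;> simp only [hσ2] <;> ring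

end Semidirect

/-! ### The self-duality equations for symmetric matrices -/

section Algebra

open Matrix

/-- The algebraic equations of a self-dual almost-Kähler structure on the Lie algebra with structure
constants `semidirectConst (S + Ω) T`, in which `J f_0` is the unit vector `e` of the ideal: the
Jacobi identity, the closedness of the Kähler form, and `W⁻ = 0`. -/
structure SelfDualEquations (S T Ω : Matrix (Fin 3) (Fin 3) ℝ) (e : Fin 3 → ℝ) : Prop where
  symm_S : Sᵀ = S
  symm_T : Tᵀ = T
  skew : Ωᵀ = -Ω
  unit : e ⬝ᵥ e = 1
  jacobi : S * T + T * S + (Ω * T - T * Ω) = S.trace • T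
  closed : (T + S + Ω) *ᵥ e = S.trace • e
  selfDual : ∃ c : ℝ, weylMatrix Ω (T - S) = c • 1

/-- The solutions of `SelfDualEquations`: either `W⁺ = 0`, or the Lie algebra is the one of the
complex hyperbolic plane and `e` spans the centre of its nilradical. -/
def FlatOrHyperbolic (S T Ω : Matrix (Fin 3) (Fin 3) ℝ) (e : Fin 3 → ℝ) : Prop :=
  (∃ c : ℝ, weylMatrix (-Ω) (T + S) = c • 1) ∨
    ∃ x : ℝ, S = -x • (1 + vecMulVec e e) ∧ T = (-2 * x) • vecMulVec e e ∧ Ω *ᵥ e = 0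

section Conjugation

variable {U : Matrix (Fin 3) (Fin 3) ℝ}

theorem conj_mul (hU : U * Uᵀ = 1) (A B : Matrix (Fin 3) (Fin 3) ℝ) :
    Uᵀ * A * U * (Uᵀ * B * U) = Uᵀ * (A * B) * U := by
  calc Uᵀ * A * U * (Uᵀ * B * U) = Uᵀ * A * (U * Uᵀ) * B * U := by noncomm_ring
    _ = Uᵀ * (A * B) * U := by rw [hU]; noncomm_ring

theorem trace_conj (hU : U * Uᵀ = 1) (A : Matrix (Fin 3) (Fin 3) ℝ) :
    (Uᵀ * A * U).trace = A.trace := by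
  rw [mul_assoc, trace_mul_comm, mul_assoc, hU, mul_one]

theorem weylMatrix_conj (hU : U * Uᵀ = 1) (Ω C : Matrix (Fin 3) (Fin 3) ℝ) :
    weylMatrix (Uᵀ * Ω * U) (Uᵀ * C * U) = Uᵀ * weylMatrix Ω C * U := by
  simp only [weylMatrix, conj_mul hU, trace_conj hU, mul_add, add_mul, mul_sub, sub_mul,
    mul_smul_comm, smul_mul_assoc]

/-- The equations are invariant under orthogonal changes of the frame of the ideal. -/
theorem SelfDualEquations.conj {S T Ω : Matrix (Fin 3) (Fin 3) ℝ} {e : Fin 3 → ℝ}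
    (h : SelfDualEquations S T Ω e) (hU : U * Uᵀ = 1) :
    SelfDualEquations (Uᵀ * S * U) (Uᵀ * T * U) (Uᵀ * Ω * U) (Uᵀ *ᵥ e) where
  symm_S := by simp [transpose_mul, h.symm_S, mul_assoc]
  symm_T := by simp [transpose_mul, h.symm_T, mul_assoc]
  skew := by simp [transpose_mul, h.skew, mul_assoc]
  unit := by
    rw [dotProduct_mulVec, vecMul_transpose, mulVec_mulVec, hU, one_mulVec, h.unit]
  jacobi := by
    simp only [conj_mul hU, trace_conj hU]
    rw [← add_mul, ← mul_add, ← sub_mul, ← mul_sub, ← add_mul, ← mul_add, h.jacobi,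
      mul_smul_comm, smul_mul_assoc]
  closed := by
    rw [← add_mul, ← mul_add, ← add_mul, ← mul_add, mulVec_mulVec, mul_assoc, hU, mul_one,
      ← mulVec_mulVec, h.closed, trace_conj hU, mulVec_smul]
  selfDual := by
    obtain ⟨c, hc⟩ := h.selfDual
    refine ⟨c, ?_⟩
    rw [← sub_mul, ← mul_sub, weylMatrix_conj hU, hc, mul_smul_comm, smul_mul_assoc, mul_one,
      mul_eq_one_comm.mp hU]

theorem FlatOrHyperbolic.of_conj {S T Ω : Matrix (Fin 3) (Fin 3) ℝ} {e : Fin 3 → ℝ}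
    (hU : U * Uᵀ = 1)
    (h : FlatOrHyperbolic (Uᵀ * S * U) (Uᵀ * T * U) (Uᵀ * Ω * U) (Uᵀ *ᵥ e)) :
    FlatOrHyperbolic S T Ω e := by
  have back : ∀ A : Matrix (Fin 3) (Fin 3) ℝ, U * (Uᵀ * A * U) * Uᵀ = A := fun A => by
    calc U * (Uᵀ * A * U) * Uᵀ = (U * Uᵀ) * A * (U * Uᵀ) := by noncomm_ring
      _ = A := by rw [hU, one_mul, mul_one]
  have outer : vecMulVec (Uᵀ *ᵥ e) (Uᵀ *ᵥ e) = Uᵀ * vecMulVec e e * U := by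
    rw [mul_vecMulVec, vecMulVec_mul, ← mulVec_transpose]
  have inj : ∀ {A B : Matrix (Fin 3) (Fin 3) ℝ}, Uᵀ * A * U = Uᵀ * B * U → A = B :=
    fun {A B} hAB => by rw [← back A, hAB, back]
  have one : Uᵀ * 1 * U = 1 := by rw [mul_one, mul_eq_one_comm.mp hU]
  rcases h with ⟨c, hc⟩ | ⟨x, hS, hT, hΩ⟩
  · refine Or.inl ⟨c, inj ?_⟩
    rw [← weylMatrix_conj hU, mul_neg, neg_mul, mul_add, add_mul, hc, mul_smul_comm,
      smul_mul_assoc, one]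
  · refine Or.inr ⟨x, inj ?_, inj ?_, ?_⟩
    · rw [hS, outer, mul_smul_comm, smul_mul_assoc, mul_add, add_mul, one]
    · rw [hT, outer, mul_smul_comm, smul_mul_assoc]
    · rw [mulVec_mulVec, mul_assoc, hU, mul_one, ← mulVec_mulVec] at hΩ
      have := congrArg (fun v => U *ᵥ v) hΩ
      simpa [mulVec_mulVec, ← mul_assoc, hU] using this

end Conjugation

theorem exists_diagonal_conj {C : Matrix (Fin 3) (Fin 3) ℝ} (hC : Cᵀ = C) :
    ∃ (U : Matrix (Fin 3) (Fin 3) ℝ) (d : Fin 3 → ℝ), U * Uᵀ = 1 ∧ Uᵀ * C * U = diagonal d := by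
  have hH : C.IsHermitian := by rwa [IsHermitian, conjTranspose_eq_transpose_of_trivial]
  let U : Matrix (Fin 3) (Fin 3) ℝ := hH.eigenvectorUnitary
  have hU : U * Uᵀ = 1 := by
    have := Unitary.coe_mul_star_self hH.eigenvectorUnitary
    rwa [Unitary.coe_star, star_eq_conjTranspose, conjTranspose_eq_transpose_of_trivial] at this
  refine ⟨U, hH.eigenvalues, hU, ?_⟩
  have h := hH.spectral_theorem
  rw [Unitary.conjStarAlgAut_apply, star_eq_conjTranspose,
    conjTranspose_eq_transpose_of_trivial] at h
  have hU' : Uᵀ * U = 1 := mul_eq_one_comm.mp hU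
  conv_lhs => rw [h]
  change Uᵀ * (U * diagonal hH.eigenvalues * Uᵀ) * U = _
  calc Uᵀ * (U * diagonal hH.eigenvalues * Uᵀ) * U
      = (Uᵀ * U) * diagonal hH.eigenvalues * (Uᵀ * U) := by noncomm_ring
    _ = _ := by rw [hU', one_mul, mul_one]

theorem weylMatrix_diagonal_apply (Ω : Matrix (Fin 3) (Fin 3) ℝ) (d : Fin 3 → ℝ) (i j : Fin 3) :
    weylMatrix Ω (diagonal d) i j =
      (if i = j then 2 * d i ^ 2 - (∑ k, d k) * d i else 0) + Ω i j * (d j - d i) := by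
  simp only [weylMatrix, Matrix.add_apply, Matrix.sub_apply, Matrix.smul_apply,
    diagonal_mul_diagonal, trace_diagonal, mul_diagonal, diagonal_mul, diagonal_apply, smul_eq_mul]
  split_ifs <;> ring

theorem weylMatrix_diagonal_eq {Ω : Matrix (Fin 3) (Fin 3) ℝ} {d : Fin 3 → ℝ} {c : ℝ}
    (hΩ : ∀ i j, Ω i j * (d j - d i) = 0) (hd : ∀ i, 2 * d i ^ 2 - (∑ k, d k) * d i = c) :
    weylMatrix Ω (diagonal d) = c • 1 := by
  ext i j
  rw [weylMatrix_diagonal_apply, hΩ, hd, Matrix.smul_apply, one_apply, add_zero, smul_ite]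
  simp

/-- The case in which `T - S` is a multiple of the identity: the opposite orientation of the complex
hyperbolic plane occurs here, and is excluded by the closedness of the Kähler form. -/
theorem flatOrHyperbolic_of_diagonal {S T Ω : Matrix (Fin 3) (Fin 3) ℝ} {e : Fin 3 → ℝ}
    (h : SelfDualEquations S T Ω e) {x : ℝ} {s : Fin 3 → ℝ} (hC : T - S = x • 1)
    (hS : S = diagonal s) : FlatOrHyperbolic S T Ω e := by
  have hT : T = diagonal fun i => s i + x := by
    rw [← sub_add_cancel T S, hC, hS, smul_one_eq_diagonal, diagonal_add]
    simp only [add_comm]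
  have hJ : ∀ i j, (if i = j then 2 * s i * (s i + x) else 0) + Ω i j * (s j - s i) =
      if i = j then (∑ k, s k) * (s i + x) else 0 := fun i j => by
    have := congrFun (congrFun h.jacobi i) j
    simp only [hS, hT, Matrix.add_apply, Matrix.sub_apply, Matrix.smul_apply,
      diagonal_mul_diagonal, trace_diagonal, mul_diagonal, diagonal_mul, diagonal_apply,
      smul_eq_mul, mul_ite, mul_zero] at this
    rw [← this]
    split_ifs <;> ring
  have hK : ∀ i, (2 * s i + x) * e i + ∑ k, Ω i k * e k = (∑ k, s k) * e i := fun i => by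
    have := congrFun h.closed i
    simp only [hS, hT, add_mulVec, Pi.add_apply, mulVec_diagonal, trace_diagonal, Pi.smul_apply,
      smul_eq_mul] at this
    rw [← this, mulVec, dotProduct]
    ring
  have hΩ : ∀ i j, Ω i j * (s j - s i) = 0 := fun i j => by
    rcases eq_or_ne i j with rfl | hij
    · ring
    · simpa [hij] using hJ i j
  have hs : ∀ i, s i + x = 0 ∨ 2 * s i = ∑ k, s k := fun i => by
    have := hJ i i
    simp only [if_true, sub_self, mul_zero, add_zero] at this
    have h' : (s i + x) * (2 * s i - ∑ k, s k) = 0 := by linear_combination this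
    exact (mul_eq_zero.mp h').imp id sub_eq_zero.mp
  have hu : e 0 * e 0 + e 1 * e 1 + e 2 * e 2 = 1 := by
    rw [← h.unit, dotProduct, Fin.sum_univ_three]
  -- pairing the closedness equation with `e` removes the skew part `Ω`
  have hq : (2 * s 0 + x) * e 0 ^ 2 + (2 * s 1 + x) * e 1 ^ 2 + (2 * s 2 + x) * e 2 ^ 2 =
      s 0 + s 1 + s 2 := by
    have k0 := hK 0
    have k1 := hK 1
    have k2 := hK 2
    simp only [Fin.sum_univ_three, apply_self_of_skew h.skew, apply_swap_of_skew h.skew 0 1,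
      apply_swap_of_skew h.skew 0 2, apply_swap_of_skew h.skew 1 2] at k0 k1 k2
    linear_combination e 0 * k0 + e 1 * k1 + e 2 * k2 + (s 0 + s 1 + s 2) * hu
  have hD : T + S = diagonal fun i => 2 * s i + x := by
    rw [hT, hS, diagonal_add]
    congr 1
    funext i
    ring
  -- `W⁺` is a multiple of `x • S` up to the identity
  have flat : (∀ i, x * (s i - s 0) = 0) → FlatOrHyperbolic S T Ω e := fun hx => by
    refine Or.inl ⟨2 * (2 * s 0 + x) ^ 2 - (∑ k, (2 * s k + x)) * (2 * s 0 + x), ?_⟩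
    rw [hD]
    refine weylMatrix_diagonal_eq (fun i j => ?_) fun i => ?_
    · rw [Matrix.neg_apply]
      linear_combination -2 * hΩ i j
    · have h0 := hJ 0 0
      have hi := hJ i i
      simp only [if_true, sub_self, mul_zero, add_zero, Fin.sum_univ_three] at h0 hi
      simp only [Fin.sum_univ_three]
      linear_combination 4 * hi - 4 * h0 - 6 * hx i
  rw [Fin.sum_univ_three] at hs
  have hx0 : x = 0 → FlatOrHyperbolic S T Ω e := fun hx => flat fun i => by rw [hx, zero_mul]
  have heq : s 1 = s 0 → s 2 = s 0 → FlatOrHyperbolic S T Ω e := fun h1 h2 => flat fun i => by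
    fin_cases i <;> simp [h1, h2]
  -- a simple eigenvalue `tr S / 2` forces `x = 0`
  have hcontra : ∀ a b c : ℝ, 0 ≤ a → a ≤ 1 → a + b + c = 1 →
      (-3 * x) * a + (-x) * b + (-x) * c = -4 * x → x = 0 := fun a b c h0 h1 h2 h3 => by
    by_contra hx
    have h4 : x * (3 - 2 * a) = 0 := by linear_combination h3 + x * h2
    rcases mul_eq_zero.mp h4 with h5 | h5
    · exact hx h5
    · linarith
  have n0 := sq_nonneg (e 0)
  have n1 := sq_nonneg (e 1)
  have n2 := sq_nonneg (e 2)
  rcases hs 0 with h0 | h0 <;> rcases hs 1 with h1 | h1 <;> rcases hs 2 with h2 | h2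
  · exact heq (by linarith) (by linarith)
  · refine hx0 (hcontra (e 2 ^ 2) (e 0 ^ 2) (e 1 ^ 2) n2 (by linarith) (by linarith) ?_)
    have e0 : s 0 = -x := by linarith
    have e1 : s 1 = -x := by linarith
    have e2 : s 2 = -2 * x := by linarith
    rw [e0, e1, e2] at hq
    linarith
  · refine hx0 (hcontra (e 1 ^ 2) (e 0 ^ 2) (e 2 ^ 2) n1 (by linarith) (by linarith) ?_)
    have e0 : s 0 = -x := by linarith
    have e1 : s 1 = -2 * x := by linarith
    have e2 : s 2 = -x := by linarith
    rw [e0, e1, e2] at hq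
    linarith
  · exact hx0 (by linarith)
  · refine hx0 (hcontra (e 0 ^ 2) (e 1 ^ 2) (e 2 ^ 2) n0 (by linarith) (by linarith) ?_)
    have e0 : s 0 = -2 * x := by linarith
    have e1 : s 1 = -x := by linarith
    have e2 : s 2 = -x := by linarith
    rw [e0, e1, e2] at hq
    linarith
  · exact hx0 (by linarith)
  · exact hx0 (by linarith)
  · exact heq (by linarith) (by linarith)

/-- The equations satisfied by the entries `s, w₁, w₂, p, q, r` of `S` and the nonzero entry `o` of
`Ω` when `T - S` is the diagonal matrix `(0, x, x)`.  If `w ≠ 0`, comparing the two expressions for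
the norm of the trace-free part of `!![p, r; r, q]` applied to `w` gives `x ^ 2 + o ^ 2 = 0`. -/
theorem entries_of_projection {s w₁ w₂ p q r o x σ : ℝ} (hx : x ≠ 0) (hσ : σ = s + p + q)
    (h00 : 2 * (s ^ 2 + w₁ ^ 2 + w₂ ^ 2) = σ * s)
    (h01 : 2 * (s * w₁ + w₁ * p + w₂ * r) + x * w₁ + o * w₂ = σ * w₁)
    (h02 : 2 * (s * w₂ + w₁ * r + w₂ * q) + x * w₂ - o * w₁ = σ * w₂)
    (h11 : 2 * (w₁ ^ 2 + p ^ 2 + r ^ 2) + 2 * x * p + 2 * o * r = σ * (p + x))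
    (h22 : 2 * (w₂ ^ 2 + r ^ 2 + q ^ 2) + 2 * x * q - 2 * o * r = σ * (q + x))
    (h12 : 2 * (w₁ * w₂ + p * r + r * q) + 2 * x * r + o * (q - p) = σ * r) :
    w₁ = 0 ∧ w₂ = 0 ∧ r = 0 ∧ p = q ∧ (s = 0 ∨ s = -2 * x ∧ p = -x) := by
  subst hσ
  -- twice the squared norm of the trace-free part
  have hn : (p - q) ^ 2 + 4 * r ^ 2 = s ^ 2 + 2 * s * x := by
    linear_combination h11 + h22 - h00
  have hw : w₁ ^ 2 + w₂ ^ 2 = 0 := by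
    -- twice the trace-free part applied to `w`
    have h1 : (p - q) * w₁ + 2 * r * w₂ = -((s + x) * w₁ + o * w₂) := by
      linear_combination h01
    have h2 : 2 * r * w₁ - (p - q) * w₂ = -((s + x) * w₂ - o * w₁) := by
      linear_combination h02
    -- a trace-free symmetric matrix of order 2 is a multiple of an isometry
    have h3 : (x ^ 2 + o ^ 2) * (w₁ ^ 2 + w₂ ^ 2) = 0 := by
      linear_combination (w₁ ^ 2 + w₂ ^ 2) * hn
        - ((p - q) * w₁ + 2 * r * w₂ - ((s + x) * w₁ + o * w₂)) * h1
        - (2 * r * w₁ - (p - q) * w₂ - ((s + x) * w₂ - o * w₁)) * h2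
    rcases mul_eq_zero.mp h3 with h | h
    · exact absurd h (by positivity)
    · exact h
  have hw₁ : w₁ = 0 := by nlinarith [sq_nonneg w₁, sq_nonneg w₂]
  have hw₂ : w₂ = 0 := by nlinarith [sq_nonneg w₁, sq_nonneg w₂]
  subst hw₁ hw₂
  have hs : s = 0 ∨ s = p + q := by
    have : s * (s - (p + q)) = 0 := by linear_combination h00
    exact (mul_eq_zero.mp this).imp id sub_eq_zero.mp
  have h1 : (p + q + 2 * x - s) * (p - q) + 4 * o * r = 0 := by linear_combination h11 - h22
  have h2 : (p + q + 2 * x - s) * (2 * r) - 2 * o * (p - q) = 0 := by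
    linear_combination 2 * h12
  have h3 : ((p + q + 2 * x - s) ^ 2 + 4 * o ^ 2) * ((p - q) ^ 2 + 4 * r ^ 2) = 0 := by
    linear_combination ((p + q + 2 * x - s) * (p - q) + 4 * o * r) * h1 +
      ((p + q + 2 * x - s) * (2 * r) - 2 * o * (p - q)) * h2
  have hn0 : (p - q) ^ 2 + 4 * r ^ 2 = 0 := by
    rcases mul_eq_zero.mp h3 with h | h
    · have h4 : p + q + 2 * x - s = 0 := by nlinarith [sq_nonneg (p + q + 2 * x - s), sq_nonneg o]
      rcases hs with h5 | h5
      · rw [hn, h5]; ring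
      · exact absurd (by linarith) hx
    · exact h
  have hr : r = 0 := by nlinarith [sq_nonneg (p - q), sq_nonneg r]
  have hpq : p = q := by nlinarith [sq_nonneg (p - q), sq_nonneg r]
  refine ⟨rfl, rfl, hr, hpq, ?_⟩
  have h6 : s * (s + 2 * x) = 0 := by linear_combination hn0 - hn
  rcases mul_eq_zero.mp h6 with h | h
  · exact Or.inl h
  · rcases hs with h' | h'
    · exact Or.inl h'
    · exact Or.inr ⟨by linarith, by linarith⟩

/-- On the Lie algebra of the complex hyperbolic plane, closedness forces `e` to be central in the
nilradical. -/
theorem flatOrHyperbolic_of_hyperbolic {S T Ω : Matrix (Fin 3) (Fin 3) ℝ} {e : Fin 3 → ℝ}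
    (h : SelfDualEquations S T Ω e) {x : ℝ} (hx : x ≠ 0) (hS : S = diagonal ![-2 * x, -x, -x])
    (hT : T = diagonal ![-2 * x, 0, 0]) (o01 : Ω 0 1 = 0) (o02 : Ω 0 2 = 0) :
    FlatOrHyperbolic S T Ω e := by
  have o10 := apply_swap_of_skew h.skew 0 1
  have o20 := apply_swap_of_skew h.skew 0 2
  have o21 := apply_swap_of_skew h.skew 1 2
  have o00 := apply_self_of_skew h.skew 0
  have o11 := apply_self_of_skew h.skew 1
  have o22 := apply_self_of_skew h.skew 2
  rw [o01, neg_zero] at o10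
  rw [o02, neg_zero] at o20
  have hcl := h.closed
  rw [hT, hS] at hcl
  have k1 := congrFun hcl 1
  have k2 := congrFun hcl 2
  simp [trace_diagonal, Fin.sum_univ_three, mulVec, dotProduct,
    o10, o11, o20, o21, o22] at k1 k2
  have he : (9 * x ^ 2 + Ω 1 2 ^ 2) * (e 1 ^ 2 + e 2 ^ 2) = 0 := by
    linear_combination (3 * x * e 1 + Ω 1 2 * e 2) * k1 + (3 * x * e 2 - Ω 1 2 * e 1) * k2
  have he' : e 1 ^ 2 + e 2 ^ 2 = 0 := (mul_eq_zero.mp he).resolve_left (by positivity)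
  have e1 : e 1 = 0 := by nlinarith [sq_nonneg (e 1), sq_nonneg (e 2)]
  have e2 : e 2 = 0 := by nlinarith [sq_nonneg (e 1), sq_nonneg (e 2)]
  have e0 : e 0 * e 0 = 1 := by
    have := h.unit
    rw [dotProduct, Fin.sum_univ_three, e1, e2] at this
    linarith
  refine Or.inr ⟨x, ?_, ?_, ?_⟩
  · rw [hS]
    ext i j
    fin_cases i <;> fin_cases j <;> simp [vecMulVec_apply, e0, e1, e2] <;> ring
  · rw [hT]
    ext i j
    fin_cases i <;> fin_cases j <;> simp [vecMulVec_apply, e0, e1, e2]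
  · ext i
    rw [mulVec, dotProduct, Fin.sum_univ_three, e1, e2]
    fin_cases i <;> simp [o00, o10, o20]

/-- The case in which `T - S` is a nonzero multiple of an orthogonal projection of rank two. -/
theorem flatOrHyperbolic_of_projection {S T Ω : Matrix (Fin 3) (Fin 3) ℝ} {e : Fin 3 → ℝ}
    (h : SelfDualEquations S T Ω e) {x : ℝ} (hx : x ≠ 0) (hC : T - S = diagonal ![0, x, x]) :
    FlatOrHyperbolic S T Ω e := by
  have hT : T = S + diagonal ![0, x, x] := by rw [← hC]; abel
  have s10 : S 1 0 = S 0 1 := congrFun (congrFun h.symm_S 0) 1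
  have s20 : S 2 0 = S 0 2 := congrFun (congrFun h.symm_S 0) 2
  have s21 : S 2 1 = S 1 2 := congrFun (congrFun h.symm_S 1) 2
  have o10 := apply_swap_of_skew h.skew 0 1
  have o20 := apply_swap_of_skew h.skew 0 2
  have o21 := apply_swap_of_skew h.skew 1 2
  have o00 := apply_self_of_skew h.skew 0
  have o11 := apply_self_of_skew h.skew 1
  have o22 := apply_self_of_skew h.skew 2
  obtain ⟨c, hc⟩ := h.selfDual
  rw [hC] at hc
  have o01 : Ω 0 1 = 0 := by
    have := congrFun (congrFun hc 0) 1
    rw [weylMatrix_diagonal_apply] at this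
    simpa [hx] using this
  have o02 : Ω 0 2 = 0 := by
    have := congrFun (congrFun hc 0) 2
    rw [weylMatrix_diagonal_apply] at this
    simpa [hx] using this
  rw [o01, neg_zero] at o10
  rw [o02, neg_zero] at o20
  have hJ := h.jacobi
  rw [hT] at hJ
  have J : ∀ i j, _ := fun i j => congrFun (congrFun hJ i) j
  simp only [mul_add, add_mul, Matrix.add_apply, Matrix.sub_apply, Matrix.smul_apply, mul_apply,
    Fin.sum_univ_three, trace, diag_apply, smul_eq_mul] at J
  have j00 := J 0 0
  have j01 := J 0 1
  have j02 := J 0 2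
  have j11 := J 1 1
  have j22 := J 2 2
  have j12 := J 1 2
  simp [s10, s20, s21, o10, o20, o21, o00, o11, o22, o01, o02] at j00 j01 j02 j11 j12 j22
  obtain ⟨hw₁, hw₂, hr, hpq, hs⟩ := entries_of_projection (s := S 0 0) (w₁ := S 0 1) (w₂ := S 0 2)
    (p := S 1 1) (q := S 2 2) (r := S 1 2) (o := Ω 1 2) (x := x) hx rfl
    (by linear_combination j00) (by linear_combination j01) (by linear_combination j02)
    (by linear_combination j11) (by linear_combination j22) (by linear_combination j12)
  have hS : S = diagonal ![S 0 0, S 2 2, S 2 2] := by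
    ext i j
    fin_cases i <;> fin_cases j <;> simp [s10, s20, s21, hw₁, hw₂, hr, hpq]
  rcases hs with hs | ⟨hs, hp⟩
  · refine Or.inl ⟨0, ?_⟩
    have hD : T + S = diagonal ![0, x + 2 * S 2 2, x + 2 * S 2 2] := by
      rw [hT, hS, diagonal_add, diagonal_add]
      congr 1
      funext i
      fin_cases i <;> simp [hs] <;> ring
    rw [hD]
    refine weylMatrix_diagonal_eq (fun i j => ?_) fun i => ?_
    · fin_cases i <;> fin_cases j <;> simp [o01, o02, o10, o20]
    · rw [Fin.sum_univ_three]
      fin_cases i <;> simp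
      all_goals ring
  · have hq : S 2 2 = -x := by rw [← hpq, hp]
    rw [hs, hq] at hS
    have hT' : T = diagonal ![-2 * x, 0, 0] := by
      rw [hT, hS, diagonal_add]
      congr 1
      funext i
      fin_cases i <;> simp
    exact flatOrHyperbolic_of_hyperbolic h hx hS hT' o01 o02

/-- If `2 C² - tr C • C` is a multiple of the identity, the symmetric matrix `C` has either a single
eigenvalue, or the eigenvalues `0, x, x`. -/
theorem eigenvalues_of_quadratic {d : Fin 3 → ℝ} {c : ℝ}
    (hd : ∀ i, 2 * d i ^ 2 - (∑ k, d k) * d i = c) :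
    (∃ x, d = fun _ => x) ∨
      ∃ x, x ≠ 0 ∧ (d = ![0, x, x] ∨ d = ![x, 0, x] ∨ d = ![x, x, 0]) := by
  have h : ∀ i j, d i = d j ∨ 2 * (d i + d j) = d 0 + d 1 + d 2 := fun i j => by
    have hi := hd i
    have hj := hd j
    rw [Fin.sum_univ_three] at hi hj
    have : (d i - d j) * (2 * (d i + d j) - (d 0 + d 1 + d 2)) = 0 := by
      linear_combination hi - hj
    exact (mul_eq_zero.mp this).imp sub_eq_zero.mp sub_eq_zero.mp
  by_cases h01 : d 0 = d 1
  · by_cases h02 : d 0 = d 2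
    · exact Or.inl ⟨d 0, funext fun i => by fin_cases i <;> simp [← h01, ← h02]⟩
    · have h2 := (h 0 2).resolve_left h02
      have h3 : d 2 = 0 := by linarith
      refine Or.inr ⟨d 0, fun h0 => h02 (by rw [h0, h3]), Or.inr (Or.inr ?_)⟩
      funext i
      fin_cases i <;> simp [h01, h3]
  · have h1 := (h 0 1).resolve_left h01
    by_cases h02 : d 0 = d 2
    · have h3 : d 1 = 0 := by linarith
      refine Or.inr ⟨d 0, fun h0 => h01 (by rw [h0, h3]), Or.inr (Or.inl ?_)⟩
      funext i
      fin_cases i <;> simp [h02, h3]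
    · have h2 := (h 0 2).resolve_left h02
      have h3 : d 0 = 0 := by linarith
      refine Or.inr ⟨d 1, fun h0 => h01 (by rw [h0, h3]), Or.inl ?_⟩
      have h4 : d 2 = d 1 := by linarith
      funext i
      fin_cases i <;> simp [h4, h3]

/-- The classification of the solutions: in an eigenbasis of `T - S`, the equation `W⁻ = 0` says
that `Ω` commutes with `T - S` and restricts its eigenvalues; the Jacobi identity then
determines `S`. -/
theorem SelfDualEquations.flatOrHyperbolic {S T Ω : Matrix (Fin 3) (Fin 3) ℝ} {e : Fin 3 → ℝ}
    (h : SelfDualEquations S T Ω e) : FlatOrHyperbolic S T Ω e := by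
  obtain ⟨U, d, hU, hd⟩ := exists_diagonal_conj (C := T - S)
    (by rw [transpose_sub, h.symm_S, h.symm_T])
  rw [mul_sub, sub_mul] at hd
  refine FlatOrHyperbolic.of_conj hU ?_
  replace h := h.conj hU
  generalize Uᵀ * S * U = S' at *
  generalize Uᵀ * T * U = T' at *
  generalize Uᵀ * Ω * U = Ω' at *
  generalize Uᵀ *ᵥ e = e' at *
  obtain ⟨c, hc⟩ := h.selfDual
  rw [hd] at hc
  have hq : ∀ i, 2 * d i ^ 2 - (∑ k, d k) * d i = c := fun i => by
    have := congrFun (congrFun hc i) i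
    rw [weylMatrix_diagonal_apply] at this
    simpa using this
  rcases eigenvalues_of_quadratic hq with ⟨x, rfl⟩ | ⟨x, hx, rfl | rfl | rfl⟩
  · rw [← smul_one_eq_diagonal] at hd
    -- every orthogonal change of frame preserves `T - S`, so that `S` can be diagonalized as well
    obtain ⟨V, s, hV, hs⟩ := exists_diagonal_conj h.symm_S
    refine FlatOrHyperbolic.of_conj hV (flatOrHyperbolic_of_diagonal (x := x) (h.conj hV) ?_ hs)
    rw [← sub_mul, ← mul_sub, hd, mul_smul_comm, smul_mul_assoc, mul_one, mul_eq_one_comm.mp hV]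
  · exact flatOrHyperbolic_of_projection h hx hd
  · have hV : (!![0, 1, 0; 1, 0, 0; 0, 0, 1] : Matrix (Fin 3) (Fin 3) ℝ) *
        (!![0, 1, 0; 1, 0, 0; 0, 0, 1] : Matrix (Fin 3) (Fin 3) ℝ)ᵀ = 1 := by
      ext i j
      fin_cases i <;> fin_cases j <;> simp [mul_apply, Fin.sum_univ_three]
    refine FlatOrHyperbolic.of_conj hV (flatOrHyperbolic_of_projection (h.conj hV) hx ?_)
    rw [← sub_mul, ← mul_sub, hd]
    ext i j
    fin_cases i <;> fin_cases j <;> simp [mul_apply, Fin.sum_univ_three]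
  · have hV : (!![0, 0, 1; 0, 1, 0; 1, 0, 0] : Matrix (Fin 3) (Fin 3) ℝ) *
        (!![0, 0, 1; 0, 1, 0; 1, 0, 0] : Matrix (Fin 3) (Fin 3) ℝ)ᵀ = 1 := by
      ext i j
      fin_cases i <;> fin_cases j <;> simp [mul_apply, Fin.sum_univ_three]
    refine FlatOrHyperbolic.of_conj hV (flatOrHyperbolic_of_projection (h.conj hV) hx ?_)
    rw [← sub_mul, ← mul_sub, hd]
    ext i j
    fin_cases i <;> fin_cases j <;> simp [mul_apply, Fin.sum_univ_three]

end Algebra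

/-! ### Codimension-one ideals and adapted frames -/

section Ideal

variable {𝔤 : Type*} [LieRing 𝔤] [LieAlgebra ℝ 𝔤]

/-- The adjoint representation `x ↦ (y ↦ [x, y])`, as a linear map. -/
def adjoint (𝔤 : Type*) [LieRing 𝔤] [LieAlgebra ℝ 𝔤] : 𝔤 →ₗ[ℝ] End ℝ 𝔤 :=
  LinearMap.mk₂ ℝ (fun x y => ⁅x, y⁆) add_lie smul_lie lie_add lie_smul

/-- The 1-form `x ↦ tr (ad x)`. -/
noncomputable def traceAd (𝔤 : Type*) [LieRing 𝔤] [LieAlgebra ℝ 𝔤] : Dual ℝ 𝔤 :=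
  LinearMap.trace ℝ 𝔤 ∘ₗ adjoint 𝔤

theorem traceAd_lie (x y : 𝔤) : traceAd 𝔤 ⁅x, y⁆ = 0 := by
  have h : adjoint 𝔤 ⁅x, y⁆ = adjoint 𝔤 x * adjoint 𝔤 y - adjoint 𝔤 y * adjoint 𝔤 x :=
    LinearMap.ext fun z => lie_lie x y z
  rw [traceAd, LinearMap.comp_apply, h, map_sub, LinearMap.trace_mul_comm, sub_self]

theorem traceAd_apply (b : Basis (Fin 4) ℝ 𝔤) (x : 𝔤) :
    traceAd 𝔤 x = ∑ k, b.repr ⁅x, b k⁆ k := by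
  rw [traceAd, LinearMap.comp_apply, LinearMap.trace_eq_matrix_trace ℝ b, Matrix.trace]
  simp [LinearMap.toMatrix_apply, adjoint]

theorem map_lie_eq_sum (b : Basis (Fin 4) ℝ 𝔤) (α : Dual ℝ 𝔤) (x y : 𝔤) (j : Fin 4)
    (hj : y = b j) : α ⁅x, y⁆ = ∑ m, b.repr x m * α ⁅b m, b j⁆ := by
  subst hj
  conv_lhs => rw [← b.sum_repr x]
  simp only [sum_lie, smul_lie, map_sum, map_smul, smul_eq_mul]

/-- On a unimodular Lie algebra of dimension 4, `dα ∧ dα = d(α ∧ dα) = 0` for every 1-form `α`. -/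
theorem extDeriv_wedge_self_eq_zero (b : Basis (Fin 4) ℝ 𝔤) (hτ : traceAd 𝔤 = 0) (α : Dual ℝ 𝔤) :
    α ⁅b 0, b 1⁆ * α ⁅b 2, b 3⁆ - α ⁅b 0, b 2⁆ * α ⁅b 1, b 3⁆ +
      α ⁅b 0, b 3⁆ * α ⁅b 1, b 2⁆ = 0 := by
  have hJ : ∀ i j k, (∑ m, b.repr ⁅b i, b j⁆ m * α ⁅b m, b k⁆) +
      (∑ m, b.repr ⁅b j, b k⁆ m * α ⁅b m, b i⁆) +
      (∑ m, b.repr ⁅b k, b i⁆ m * α ⁅b m, b j⁆) = 0 := fun i j k => by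
    rw [← map_lie_eq_sum b α _ _ k rfl, ← map_lie_eq_sum b α _ _ i rfl,
      ← map_lie_eq_sum b α _ _ j rfl, ← map_add, ← map_add]
    have h : ⁅⁅b i, b j⁆, b k⁆ + ⁅⁅b j, b k⁆, b i⁆ + ⁅⁅b k, b i⁆, b j⁆ = 0 := by
      have h := lie_jacobi (b i) (b j) (b k)
      rw [← lie_skew (b i) ⁅b j, b k⁆, ← lie_skew (b j) ⁅b k, b i⁆,
        ← lie_skew (b k) ⁅b i, b j⁆] at h
      rw [← neg_eq_zero, ← h]
      abel
    rw [h, map_zero]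
  have hT : ∀ i, ∑ k, b.repr ⁅b i, b k⁆ k = 0 := fun i => by
    rw [← traceAd_apply b, hτ, LinearMap.zero_apply]
  have hD : ∀ i j, α ⁅b i, b j⁆ = ∑ m, b.repr ⁅b i, b j⁆ m * α (b m) := fun i j => by
    conv_lhs => rw [← b.sum_repr ⁅b i, b j⁆]
    simp only [map_sum, map_smul, smul_eq_mul]
  have hs : ∀ i j m, b.repr ⁅b j, b i⁆ m = - b.repr ⁅b i, b j⁆ m := fun i j m => by
    rw [← lie_skew, map_neg, Finsupp.neg_apply]
  have hs' : ∀ i j, α ⁅b j, b i⁆ = - α ⁅b i, b j⁆ := fun i j => by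
    rw [← lie_skew, map_neg]
  have j0 := hJ 1 2 3
  have j1 := hJ 0 2 3
  have j2 := hJ 0 1 3
  have j3 := hJ 0 1 2
  have t0 := hT 0
  have t1 := hT 1
  have t2 := hT 2
  have t3 := hT 3
  simp only [Fin.sum_univ_four, hs 0 1, hs 0 2, hs 0 3, hs 1 2, hs 1 3, hs 2 3,
    hs' 0 1, hs' 0 2, hs' 0 3, hs' 1 2, hs' 1 3, hs' 2 3, lie_self, map_zero, Finsupp.zero_apply]
    at j0 j1 j2 j3 t0 t1 t2 t3
  have d01 := hD 0 1
  have d02 := hD 0 2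
  have d03 := hD 0 3
  have d12 := hD 1 2
  have d13 := hD 1 3
  have d23 := hD 2 3
  rw [Fin.sum_univ_four] at d01 d02 d03 d12 d13 d23
  generalize α ⁅b 0, b 1⁆ = D01 at *
  generalize α ⁅b 0, b 2⁆ = D02 at *
  generalize α ⁅b 0, b 3⁆ = D03 at *
  generalize α ⁅b 1, b 2⁆ = D12 at *
  generalize α ⁅b 1, b 3⁆ = D13 at *
  generalize α ⁅b 2, b 3⁆ = D23 at *
  generalize α (b 0) = a0 at *
  generalize α (b 1) = a1 at *
  generalize α (b 2) = a2 at *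
  generalize α (b 3) = a3 at *
  -- the three groups are the definition of `dα`, the Jacobi identity in the form `α ∧ d(dα)`, and
  -- `tr (ad ·) ∧ α ∧ dα`
  linear_combination (1 / 2) * (D23 * d01 + D01 * d23 - D13 * d02 - D02 * d13 + D12 * d03 +
      D03 * d12) + (1 / 2) * (a0 * j0 - a1 * j1 + a2 * j2 - a3 * j3) +
    (1 / 2) * ((t0 * a1 - t1 * a0) * D23 - (t0 * a2 - t2 * a0) * D13 + (t0 * a3 - t3 * a0) * D12 +
      (t1 * a2 - t2 * a1) * D03 - (t1 * a3 - t3 * a1) * D02 + (t2 * a3 - t3 * a2) * D01)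

/-- A 4-dimensional Lie algebra has an ideal of codimension 1 which is unimodular: the kernel of
`tr ∘ ad`, unless this vanishes.  In the unimodular case, `α ↦ dα` maps 1-forms to forms which are
isotropic for the wedge product; by dimension it takes some `α ≠ 0` to a self-dual form, on which
the wedge product is definite, so that `dα = 0`. -/
theorem exists_closed_form [FiniteDimensional ℝ 𝔤] (hdim : finrank ℝ 𝔤 = 4) :
    ∃ α : Dual ℝ 𝔤, α ≠ 0 ∧ (∀ x y : 𝔤, α ⁅x, y⁆ = 0) ∧ ∀ x, α x = 0 → traceAd 𝔤 x = 0 := by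
  by_cases hτ : traceAd 𝔤 = 0
  swap
  · exact ⟨traceAd 𝔤, hτ, traceAd_lie, fun x hx => hx⟩
  let b : Basis (Fin 4) ℝ 𝔤 := finBasisOfFinrankEq ℝ 𝔤 hdim
  let ev : 𝔤 → Dual ℝ 𝔤 →ₗ[ℝ] ℝ := fun x => Dual.eval ℝ 𝔤 x
  let φ : Dual ℝ 𝔤 →ₗ[ℝ] (Fin 3 → ℝ) := LinearMap.pi
    ![ev ⁅b 0, b 1⁆ - ev ⁅b 2, b 3⁆, ev ⁅b 0, b 2⁆ + ev ⁅b 1, b 3⁆, ev ⁅b 0, b 3⁆ - ev ⁅b 1, b 2⁆]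
  have hker : LinearMap.ker φ ≠ ⊥ := by
    refine LinearMap.ker_ne_bot_of_finrank_lt ?_
    rw [Subspace.dual_finrank_eq, hdim, finrank_fin_fun]
    norm_num
  obtain ⟨α, hα, hne⟩ := (Submodule.ne_bot_iff _).mp hker
  refine ⟨α, hne, ?_, fun x _ => by rw [hτ, LinearMap.zero_apply]⟩
  have h0 : α ⁅b 0, b 1⁆ - α ⁅b 2, b 3⁆ = 0 := congrFun hα 0
  have h1 : α ⁅b 0, b 2⁆ + α ⁅b 1, b 3⁆ = 0 := congrFun hα 1
  have h2 : α ⁅b 0, b 3⁆ - α ⁅b 1, b 2⁆ = 0 := congrFun hα 2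
  have hq : α ⁅b 0, b 1⁆ ^ 2 + α ⁅b 0, b 2⁆ ^ 2 + α ⁅b 0, b 3⁆ ^ 2 = 0 := by
    linear_combination extDeriv_wedge_self_eq_zero b hτ α + α ⁅b 0, b 1⁆ * h0 +
      α ⁅b 0, b 2⁆ * h1 + α ⁅b 0, b 3⁆ * h2
  have n1 := sq_nonneg (α ⁅b 0, b 1⁆)
  have n2 := sq_nonneg (α ⁅b 0, b 2⁆)
  have n3 := sq_nonneg (α ⁅b 0, b 3⁆)
  have a01 : α ⁅b 0, b 1⁆ = 0 := pow_eq_zero_iff two_ne_zero |>.mp (by linarith)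
  have a02 : α ⁅b 0, b 2⁆ = 0 := pow_eq_zero_iff two_ne_zero |>.mp (by linarith)
  have a03 : α ⁅b 0, b 3⁆ = 0 := pow_eq_zero_iff two_ne_zero |>.mp (by linarith)
  have a12 : α ⁅b 1, b 2⁆ = 0 := by linarith
  have a13 : α ⁅b 1, b 3⁆ = 0 := by linarith
  have a23 : α ⁅b 2, b 3⁆ = 0 := by linarith
  have hd : extDeriv₁ α = 0 := by
    refine isAlt_eq_zero (f := b) (fun x => ?_) (fun a => ?_) (fun a => ?_)
    · simp [extDeriv₁]
    · fin_cases a <;> simp [extDeriv₁, planeIndex, a01, a02, a03]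
    · fin_cases a
      · simpa [extDeriv₁, coplaneIndex] using a23
      · rw [← neg_eq_zero, ← map_neg, lie_skew] at a13
        simpa [extDeriv₁, coplaneIndex] using a13
      · simpa [extDeriv₁, coplaneIndex] using a12
  intro x y
  have := congrArg (fun B => B x y) hd
  simpa [extDeriv₁] using this

end Ideal

section AdaptedFrame

variable {𝔤 : Type*} [LieRing 𝔤] [LieAlgebra ℝ 𝔤] {ω : LinearMap.BilinForm ℝ 𝔤} {J : End ℝ 𝔤}
  {g : Metric 𝔤}

theorem Metric.exists_smul_unit (g : Metric 𝔤) {x : 𝔤} (hx : x ≠ 0) :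
    ∃ r : ℝ, r ≠ 0 ∧ g.form (r • x) (r • x) = 1 := by
  have hp := g.pos x hx
  refine ⟨(√(g.form x x))⁻¹, inv_ne_zero (Real.sqrt_pos.mpr hp).ne', ?_⟩
  simp only [map_smul, LinearMap.smul_apply, smul_eq_mul]
  rw [← mul_assoc, ← mul_inv, Real.mul_self_sqrt hp.le, inv_mul_cancel₀ hp.ne']

theorem IsAlmostKahler.form_map_right (h : IsAlmostKahler ω J g) (x y : 𝔤) :
    g.form x (J y) = - g.form (J x) y := by
  rw [← h.compatible x (J y), h.sq, map_neg]

theorem IsAlmostKahler.form_map_self (h : IsAlmostKahler ω J g) (x : 𝔤) : g.form (J x) x = 0 := by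
  have := h.form_map_right x x
  rw [g.symm] at this
  linarith

theorem exists_basis_of_orthonormal [FiniteDimensional ℝ 𝔤] (hdim : finrank ℝ 𝔤 = 4)
    (v : Fin 4 → 𝔤) (hv : ∀ i j, g.form (v i) (v j) = if i = j then 1 else 0) :
    ∃ f : Basis (Fin 4) ℝ 𝔤, IsOrthonormalFrame g f ∧ ∀ i, f i = v i := by
  have hli : LinearIndependent ℝ v := by
    rw [Fintype.linearIndependent_iff]
    intro c hc i
    have := congrArg (fun x => g.form x (v i)) hc
    simp only [map_sum, map_smul, LinearMap.sum_apply, LinearMap.smul_apply, hv, map_zero,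
      LinearMap.zero_apply] at this
    simpa using this
  have hf : ∀ i, basisOfLinearIndependentOfCardEqFinrank hli (by simp [hdim]) i = v i := by simp
  exact ⟨_, fun i j => by rw [hf, hf, hv], hf⟩

/-- An almost-Hermitian inner product space of dimension 4 has an orthonormal frame
`f_0, J f_0, f_2, J f_2` whose first vector is normal to a given hyperplane. -/
theorem IsAlmostKahler.exists_adapted_frame [FiniteDimensional ℝ 𝔤] (hdim : finrank ℝ 𝔤 = 4)
    (h : IsAlmostKahler ω J g) {α : Dual ℝ 𝔤} (hα : α ≠ 0) :
    ∃ f : Basis (Fin 4) ℝ 𝔤, IsOrthonormalFrame g f ∧ J (f 0) = f 1 ∧ J (f 2) = f 3 ∧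
      ∃ r : ℝ, r ≠ 0 ∧ ∀ x, g.form x (f 0) = r * α x := by
  have hn : sharp g α ≠ 0 := fun h0 => hα <| LinearMap.ext fun y => by
    rw [← form_sharp g α y, h0]; simp
  obtain ⟨r, hr, hr1⟩ := g.exists_smul_unit hn
  set n := r • sharp g α with hn_def
  let φ : 𝔤 →ₗ[ℝ] (Fin 2 → ℝ) := LinearMap.pi ![g.form n, g.form (J n)]
  have hker : LinearMap.ker φ ≠ ⊥ := by
    refine LinearMap.ker_ne_bot_of_finrank_lt ?_
    rw [hdim, finrank_fin_fun]
    norm_num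
  obtain ⟨m, hm, hm0⟩ := (Submodule.ne_bot_iff _).mp hker
  have hm1 : g.form n m = 0 := congrFun hm 0
  have hm2 : g.form (J n) m = 0 := congrFun hm 1
  obtain ⟨s, -, hs1⟩ := g.exists_smul_unit hm0
  set v := s • m with hv
  have hv1 : g.form n v = 0 := by rw [hv, map_smul, hm1, smul_zero]
  have hv2 : g.form (J n) v = 0 := by rw [hv, map_smul, hm2, smul_zero]
  have hv3 : g.form n (J v) = 0 := by rw [h.form_map_right, hv2, neg_zero]
  have hv4 : g.form (J n) (J v) = 0 := by rw [h.compatible, hv1]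
  obtain ⟨f, hf, hfv⟩ := exists_basis_of_orthonormal (g := g) hdim ![n, J n, v, J v] (by
    intro i j
    fin_cases i <;> fin_cases j <;>
      simp [hr1, hs1, hv1, hv2, hv3, hv4, h.compatible, h.form_map_self, g.symm n (J n),
        g.symm v n, g.symm v (J n), g.symm (J v) n, g.symm v (J v)])
  refine ⟨f, hf, ?_, ?_, r, hr, fun x => ?_⟩
  · rw [hfv, hfv]; rfl
  · rw [hfv, hfv]; rfl
  · rw [hfv, g.symm]
    change g.form n x = _
    rw [hn_def, map_smul, LinearMap.smul_apply, form_sharp, smul_eq_mul]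

/-- The Nijenhuis tensor of an almost complex structure is antisymmetric and `J`-antilinear, so that
in dimension 4 it is determined by a single value. -/
theorem nijenhuis_eq_zero (hJ : ∀ x, J (J x) = -x) {f : Basis (Fin 4) ℝ 𝔤} (h01 : J (f 0) = f 1)
    (h23 : J (f 2) = f 3) (hN : nijenhuis J (f 0) (f 2) = 0) (x y : 𝔤) : nijenhuis J x y = 0 := by
  have swap : ∀ x y, nijenhuis J y x = - nijenhuis J x y := fun x y => by
    simp only [nijenhuis, ← lie_skew x y, ← lie_skew (J x) (J y), ← lie_skew (J x) y,
      ← lie_skew x (J y), map_neg]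
    abel
  have left : ∀ x y, nijenhuis J (J x) y = - J (nijenhuis J x y) := fun x y => by
    simp only [nijenhuis, hJ, neg_lie, map_neg, map_sub]
    abel
  have right : ∀ x y, nijenhuis J x y = 0 → nijenhuis J x (J y) = 0 := fun x y h => by
    rw [swap, left, swap x, h]; simp
  have left' : ∀ x y, nijenhuis J x y = 0 → nijenhuis J (J x) y = 0 := fun x y h => by
    rw [left, h]; simp
  have self : ∀ x, nijenhuis J x x = 0 := fun x => by
    simp only [nijenhuis, lie_self, ← lie_skew x (J x), map_neg]
    abel
  have flip : ∀ x y, nijenhuis J x y = 0 → nijenhuis J y x = 0 := fun x y h => by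
    rw [swap, h, neg_zero]
  let B : 𝔤 →ₗ[ℝ] 𝔤 →ₗ[ℝ] 𝔤 := LinearMap.mk₂ ℝ (nijenhuis J)
    (fun _ _ _ => by simp only [nijenhuis, map_add, add_lie]; abel)
    (fun _ _ _ => by simp only [nijenhuis, map_smul, smul_lie, smul_sub])
    (fun _ _ _ => by simp only [nijenhuis, map_add, lie_add]; abel)
    (fun _ _ _ => by simp only [nijenhuis, map_smul, lie_smul, smul_sub])
  have hB : B = 0 := by
    refine f.ext fun i => f.ext fun j => ?_
    change nijenhuis J (f i) (f j) = 0
    have n02 := hN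
    have n12 := left' _ _ n02
    have n03 := right _ _ n02
    have n13 := right _ _ n12
    have n01 := right _ _ (self (f 0))
    have n23 := right _ _ (self (f 2))
    rw [h01] at n12 n13 n01
    rw [h23] at n03 n13 n23
    fin_cases i <;> fin_cases j <;> first | exact self _ | assumption | (apply flip; assumption)
  exact congrArg (fun B => B x y) hB

end AdaptedFrame

/-! ### Self-dual almost-Kähler structures -/

section SelfDual

variable {𝔤 : Type*} [LieRing 𝔤] [LieAlgebra ℝ 𝔤] {ω : LinearMap.BilinForm ℝ 𝔤} {J : End ℝ 𝔤}
  {g : Metric 𝔤} {f : Basis (Fin 4) ℝ 𝔤}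

theorem structConst_swap (i j k : Fin 4) : structConst g f j i k = - structConst g f i j k := by
  rw [structConst, ← lie_skew, map_neg, LinearMap.neg_apply]; rfl

/-- The Jacobi identity for the structure constants. -/
theorem IsOrthonormalFrame.structConst_jacobi (hf : IsOrthonormalFrame g f) (i j k l : Fin 4) :
    (∑ m, structConst g f j k m * structConst g f i m l) +
      (∑ m, structConst g f k i m * structConst g f j m l) +
      (∑ m, structConst g f i j m * structConst g f k m l) = 0 := by
  have h : ∀ i x, g.form ⁅f i, x⁆ (f l) = ∑ m, g.form x (f m) * structConst g f i m l :=
    fun i x => by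
      conv_lhs => rw [← hf.sum_form_smul x]
      simp only [lie_sum, lie_smul, map_sum, map_smul, LinearMap.sum_apply, LinearMap.smul_apply,
        smul_eq_mul]
      rfl
  have hJ := congrArg (fun v => g.form v (f l)) (lie_jacobi (f i) (f j) (f k))
  simp only [map_add, LinearMap.add_apply, h, map_zero, LinearMap.zero_apply] at hJ
  exact hJ

theorem IsOrthonormalFrame.traceAd_eq (hf : IsOrthonormalFrame g f) (i : Fin 4) :
    traceAd 𝔤 (f i) = ∑ k, structConst g f i k k := by
  rw [traceAd_apply f]
  simp_rw [hf.repr_eq]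
  rfl

theorem IsOrthonormalFrame.closed_structConst (hf : IsOrthonormalFrame g f)
    (hc : ∀ i j, ω (f i) (f j) = kahlerComponents i j) (h : IsClosedForm ω) (i j k : Fin 4) :
    -(∑ m, structConst g f i j m * kahlerComponents m k) +
      (∑ m, structConst g f i k m * kahlerComponents m j) -
      (∑ m, structConst g f j k m * kahlerComponents m i) = 0 := by
  have e : ∀ i j k, ω ⁅f i, f j⁆ (f k) = ∑ m, structConst g f i j m * kahlerComponents m k :=
    fun i j k => by
      conv_lhs => rw [← hf.sum_form_smul ⁅f i, f j⁆]
      simp only [map_sum, map_smul, LinearMap.sum_apply, LinearMap.smul_apply, smul_eq_mul, hc]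
      rfl
  have := h (f i) (f j) (f k)
  rwa [extDeriv₂, e, e, e] at this

theorem IsAlmostKahler.apply_frame (h : IsAlmostKahler ω J g) (hf : IsOrthonormalFrame g f)
    (h01 : J (f 0) = f 1) (h23 : J (f 2) = f 3) (i j : Fin 4) :
    ω (f i) (f j) = kahlerComponents i j := by
  have h10 : J (f 1) = - f 0 := by rw [← h01, h.sq]
  have h32 : J (f 3) = - f 2 := by rw [← h23, h.sq]
  rw [h.form_eq]
  fin_cases i <;> simp [h01, h23, h10, h32, hf _ _] <;>
    fin_cases j <;> simp [kahlerComponents]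

/-- When `f_0` is normal to a unimodular ideal, the bracket of the ideal is given by a symmetric
matrix, by Milnor's description of the 3-dimensional unimodular Lie algebras. -/
theorem IsOrthonormalFrame.exists_structConst_eq (hf : IsOrthonormalFrame g f)
    (h0 : ∀ x y : 𝔤, g.form ⁅x, y⁆ (f 0) = 0) (hτ : ∀ i, i ≠ 0 → traceAd 𝔤 (f i) = 0) :
    ∃ S T Ω : Matrix (Fin 3) (Fin 3) ℝ, S.transpose = S ∧ T.transpose = T ∧ Ω.transpose = -Ω ∧
      structConst g f = semidirectConst (S + Ω) T := by
  let A : Matrix (Fin 3) (Fin 3) ℝ := Matrix.of fun k j => structConst g f 0 j.succ k.succ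
  let T : Matrix (Fin 3) (Fin 3) ℝ := Matrix.of fun k j => ![structConst g f 2 3 k.succ,
    structConst g f 3 1 k.succ, structConst g f 1 2 k.succ] j
  have hs : ∀ i j k, structConst g f j i k = - structConst g f i j k :=
    structConst_swap (g := g) (f := f)
  have hz : ∀ i j, structConst g f i j 0 = 0 := fun i j => h0 _ _
  have hd : ∀ i k, structConst g f i i k = 0 := fun i k => by
    rw [structConst, lie_self, map_zero, LinearMap.zero_apply]
  have ht : ∀ i, i ≠ 0 → structConst g f i 1 1 + structConst g f i 2 2 +
      structConst g f i 3 3 = 0 := fun i hi => by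
    have hti := hτ i hi
    rwa [hf.traceAd_eq, Fin.sum_univ_four, hz i 0, zero_add] at hti
  refine ⟨(1 / 2 : ℝ) • (A + A.transpose), T, (1 / 2 : ℝ) • (A - A.transpose), ?_, ?_, ?_, ?_⟩
  · rw [Matrix.transpose_smul, Matrix.transpose_add, Matrix.transpose_transpose, add_comm]
  · have t1 := ht 1 (by decide)
    have t2 := ht 2 (by decide)
    have t3 := ht 3 (by decide)
    simp only [hd, hs 1 2, hs 1 3, hs 2 3] at t1 t2 t3
    ext i j
    fin_cases i <;> fin_cases j <;> simp [T, hs 1 3] <;> linarith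
  · rw [Matrix.transpose_smul, Matrix.transpose_sub, Matrix.transpose_transpose, ← smul_neg,
      neg_sub]
  · have hA : (1 / 2 : ℝ) • (A + A.transpose) + (1 / 2 : ℝ) • (A - A.transpose) = A := by
      rw [← smul_add, add_add_sub_cancel, ← two_smul ℝ A, smul_smul]
      norm_num
    rw [hA]
    funext i j k
    fin_cases i <;> fin_cases j <;> fin_cases k <;>
      simp [semidirectConst, A, T, hz, hd, hs 0 1, hs 0 2, hs 0 3, hs 1 2, hs 1 3, hs 2 3]

/-- In a frame `f_0, J f_0, f_2, J f_2` the vector `e = J f_0` of the ideal is `(1, 0, 0)`. -/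
theorem selfDualEquations_of_structConst (hf : IsOrthonormalFrame g f)
    (hc : ∀ i j, ω (f i) (f j) = kahlerComponents i j) (hω : IsClosedForm ω)
    {S T Ω : Matrix (Fin 3) (Fin 3) ℝ} (hS : S.transpose = S) (hT : T.transpose = T)
    (hΩ : Ω.transpose = -Ω) (hst : structConst g f = semidirectConst (S + Ω) T)
    (hW : IsScalarBlock (dualBlock (frameCurvature (structConst g f)) (-1))) :
    SelfDualEquations S T Ω ![1, 0, 0] where
  symm_S := hS
  symm_T := hT
  skew := hΩ
  unit := by simp
  jacobi := by
    have s10 : S 1 0 = S 0 1 := congrFun (congrFun hS 0) 1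
    have s20 : S 2 0 = S 0 2 := congrFun (congrFun hS 0) 2
    have s21 : S 2 1 = S 1 2 := congrFun (congrFun hS 1) 2
    have t10 : T 1 0 = T 0 1 := congrFun (congrFun hT 0) 1
    have t20 : T 2 0 = T 0 2 := congrFun (congrFun hT 0) 2
    have t21 : T 2 1 = T 1 2 := congrFun (congrFun hT 1) 2
    have o10 := apply_swap_of_skew hΩ 0 1
    have o20 := apply_swap_of_skew hΩ 0 2
    have o21 := apply_swap_of_skew hΩ 1 2
    have o00 := apply_self_of_skew hΩ 0
    have o11 := apply_self_of_skew hΩ 1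
    have o22 := apply_self_of_skew hΩ 2
    have hJ : ∀ l, _ := fun l =>
      And.intro (hf.structConst_jacobi 0 2 3 l) (And.intro (hf.structConst_jacobi 0 3 1 l)
        (hf.structConst_jacobi 0 1 2 l))
    rw [hst] at hJ
    have j1 := hJ 1
    have j2 := hJ 2
    have j3 := hJ 3
    simp [Fin.sum_univ_four, semidirectConst, s10, s20, s21, t10, t20, t21, o10, o20, o21, o00,
      o11, o22] at j1 j2 j3
    obtain ⟨j11, j12, j13⟩ := j1
    obtain ⟨j21, j22, j23⟩ := j2
    obtain ⟨j31, j32, j33⟩ := j3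
    ext i j
    fin_cases i <;> fin_cases j <;>
      simp [Matrix.mul_apply, Fin.sum_univ_three, Matrix.trace, s10, s20, s21, t10, t20, t21, o10,
        o20, o21, o00, o11, o22] <;> linarith
  closed := by
    have c1 := hf.closed_structConst hc hω 0 1 2
    have c2 := hf.closed_structConst hc hω 0 1 3
    have c3 := hf.closed_structConst hc hω 0 2 3
    rw [hst] at c1 c2 c3
    have t10 : T 1 0 = T 0 1 := congrFun (congrFun hT 0) 1
    have t20 : T 2 0 = T 0 2 := congrFun (congrFun hT 0) 2
    have o00 := apply_self_of_skew hΩ 0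
    have o11 := apply_self_of_skew hΩ 1
    have o22 := apply_self_of_skew hΩ 2
    simp [Fin.sum_univ_four, semidirectConst, kahlerComponents, o00, o11, o22] at c1 c2 c3
    ext i
    fin_cases i <;> simp [Matrix.mulVec, dotProduct, Fin.sum_univ_three, Matrix.trace, t10, t20,
      o00] <;> linarith
  selfDual := by
    obtain ⟨c, hM⟩ := hW
    rw [hst] at hM
    obtain ⟨q, hq⟩ := dualBlock_semidirectConst hS hT hΩ (σ := -1) (Or.inr rfl)
    refine ⟨q - c, ?_⟩
    ext a b
    have := hq a b
    rw [hM, neg_neg, one_smul, neg_one_smul, ← sub_eq_add_neg] at this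
    rw [Matrix.smul_apply, Matrix.one_apply, smul_eq_mul, mul_ite, mul_one, mul_zero]
    split_ifs at this ⊢ <;> linarith

theorem isScalarBlock_one_of_weylMatrix {S T Ω : Matrix (Fin 3) (Fin 3) ℝ} (hS : S.transpose = S)
    (hT : T.transpose = T) (hΩ : Ω.transpose = -Ω) {c : ℝ}
    (hc : weylMatrix (-Ω) (T + S) = c • 1) :
    IsScalarBlock (dualBlock (frameCurvature (semidirectConst (S + Ω) T)) 1) := by
  obtain ⟨q, hq⟩ := dualBlock_semidirectConst hS hT hΩ (σ := 1) (Or.inl rfl)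
  refine ⟨q - c, fun a b => ?_⟩
  rw [hq, neg_one_smul, one_smul, hc, Matrix.smul_apply, Matrix.one_apply, smul_eq_mul]
  split_ifs <;> ring

/-- The complex hyperbolic solution of `SelfDualEquations` is integrable. -/
theorem nijenhuis_frame_eq_zero (hf : IsOrthonormalFrame g f) (hJ : ∀ x, J (J x) = -x)
    (h23 : J (f 2) = f 3) (h01 : J (f 0) = f 1) {S T Ω : Matrix (Fin 3) (Fin 3) ℝ}
    (hΩ : Ω.transpose = -Ω) (hst : structConst g f = semidirectConst (S + Ω) T) {x : ℝ}
    (hSx : S = -x • (1 + Matrix.vecMulVec ![1, 0, 0] ![1, 0, 0]))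
    (hTx : T = (-2 * x) • Matrix.vecMulVec ![1, 0, 0] ![1, 0, 0])
    (hΩe : Ω.mulVec ![1, 0, 0] = 0) : nijenhuis J (f 0) (f 2) = 0 := by
  have h32 : J (f 3) = - f 2 := by rw [← h23, hJ]
  have o10 : Ω 1 0 = 0 := by
    simpa [Matrix.mulVec, dotProduct, Fin.sum_univ_three] using congrFun hΩe 1
  have o20 : Ω 2 0 = 0 := by
    simpa [Matrix.mulVec, dotProduct, Fin.sum_univ_three] using congrFun hΩe 2
  have o01 : Ω 0 1 = 0 := by rw [apply_swap_of_skew hΩ 1 0, o10, neg_zero]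
  have o02 : Ω 0 2 = 0 := by rw [apply_swap_of_skew hΩ 2 0, o20, neg_zero]
  have o21 := apply_swap_of_skew hΩ 1 2
  have o11 := apply_self_of_skew hΩ 1
  have o22 := apply_self_of_skew hΩ 2
  have hbr : ∀ i j, ⁅f i, f j⁆ = ∑ k, semidirectConst (S + Ω) T i j k • f k := fun i j => by
    rw [← hst]; exact (hf.sum_form_smul _).symm
  rw [nijenhuis, h01, h23, hbr 1 3, hbr 1 2, hbr 0 3, hbr 0 2]
  simp [Fin.sum_univ_four, semidirectConst, hSx, hTx, o01, o02, o21, o11,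
    o22, h23, h32]

/-- A self-dual almost-Kähler structure which is not conformally flat is integrable. -/
theorem IsAlmostKahler.isKahler_of_isSelfDual [FiniteDimensional ℝ 𝔤] (hdim : finrank ℝ 𝔤 = 4)
    (h : IsAlmostKahler ω J g) (hsd : IsSelfDual g (halfSquare ω))
    (hcf : ¬ IsConformallyFlat g (halfSquare ω)) : IsKahler ω J g := by
  obtain ⟨α, hα, hcl, hτ⟩ := exists_closed_form hdim
  obtain ⟨f, hf, h01, h23, r, hr, hn⟩ := h.exists_adapted_frame hdim hα
  have hc := h.apply_frame hf h01 h23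
  obtain ⟨S, T, Ω, hS, hT, hΩ, hst⟩ := hf.exists_structConst_eq
    (fun x y => by rw [hn, hcl, mul_zero]) fun i hi => hτ _ <| by
      have := hn (f i)
      rw [hf i 0, if_neg hi] at this
      exact (mul_eq_zero.mp this.symm).resolve_left hr
  have heq := selfDualEquations_of_structConst hf hc h.closed hS hT hΩ hst
    (isScalarBlock_curvature_of_isSelfDual hf hc hsd)
  rcases heq.flatOrHyperbolic with ⟨c, hW⟩ | ⟨x, hSx, hTx, hΩe⟩
  · refine absurd (fun α hα => ⟨?_, hsd α hα⟩) hcf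
    refine weylPlus_eq_zero_of_isScalarBlock hf hc ?_ hα
    rw [hst]
    exact isScalarBlock_one_of_weylMatrix hS hT hΩ hW
  · exact ⟨h, nijenhuis_eq_zero h.sq h01 h23
      (nijenhuis_frame_eq_zero hf h.sq h23 h01 hΩ hst hSx hTx hΩe)⟩

end SelfDual

/-! ### The De Smedt–Salamon model -/

section Model

variable {𝔤 : Type*} [LieRing 𝔤] [LieAlgebra ℝ 𝔤] {ω : LinearMap.BilinForm ℝ 𝔤} {J : End ℝ 𝔤}
  {g : Metric 𝔤} {lam k : ℝ} {e : Basis (Fin 4) ℝ 𝔤}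

theorem IsDeSmedtSalamonModel.repr_lie (h : IsDeSmedtSalamonModel g lam k e) (x y : 𝔤) :
    e.repr ⁅x, y⁆ 0 = 0 ∧
    e.repr ⁅x, y⁆ 1 = (e.repr x 0 * e.repr y 1 - e.repr y 0 * e.repr x 1) +
      lam * (e.repr x 0 * e.repr y 2 - e.repr y 0 * e.repr x 2) ∧
    e.repr ⁅x, y⁆ 2 = -lam * (e.repr x 0 * e.repr y 1 - e.repr y 0 * e.repr x 1) +
      (e.repr x 0 * e.repr y 2 - e.repr y 0 * e.repr x 2) ∧
    e.repr ⁅x, y⁆ 3 = 2 * (e.repr x 0 * e.repr y 3 - e.repr y 0 * e.repr x 3) -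
      (e.repr x 1 * e.repr y 2 - e.repr y 1 * e.repr x 2) := by
  have h0 := congrArg (fun B => B x y) h.d_coord₀
  have h1 := congrArg (fun B => B x y) h.d_coord₁
  have h2 := congrArg (fun B => B x y) h.d_coord₂
  have h3 := congrArg (fun B => B x y) h.d_coord₃
  simp [extDeriv₁, wedge] at h0 h1 h2 h3
  exact ⟨h0, by linarith, by linarith, by linarith⟩

theorem IsDeSmedtSalamonModel.lie_basis (h : IsDeSmedtSalamonModel g lam k e) :
    ⁅e 0, e 1⁆ = e 1 - lam • e 2 ∧ ⁅e 0, e 2⁆ = lam • e 1 + e 2 ∧ ⁅e 0, e 3⁆ = (2 : ℝ) • e 3 ∧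
      ⁅e 1, e 2⁆ = - e 3 ∧ ⁅e 1, e 3⁆ = 0 ∧ ⁅e 2, e 3⁆ = 0 := by
  refine ⟨?_, ?_, ?_, ?_, ?_, ?_⟩ <;> refine e.ext_elem fun i => ?_ <;>
    fin_cases i <;> simp [h.repr_lie]

theorem IsDeSmedtSalamonModel.exists_frame [FiniteDimensional ℝ 𝔤] (hdim : finrank ℝ 𝔤 = 4)
    (h : IsDeSmedtSalamonModel g lam k e) :
    ∃ f : Basis (Fin 4) ℝ 𝔤, IsOrthonormalFrame g f ∧ f 0 = k⁻¹ • e 0 ∧ f 1 = e 1 ∧ f 2 = e 2 ∧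
      f 3 = e 3 := by
  obtain ⟨f, hf, hv⟩ := exists_basis_of_orthonormal hdim _ h.orthonormal
  exact ⟨f, hf, hv 0, hv 1, hv 2, hv 3⟩

theorem IsAlmostKahler.isAlt (h : IsAlmostKahler ω J g) : ω.IsAlt := fun x => by
  rw [h.form_eq, h.form_map_self]

/-- In the model, a closed form has only the components along `e^{12}`, `e^{13}` and
`-2 e^{14} + e^{23}`, and orthogonality of `J` then determines `ω` up to sign. -/
theorem IsDeSmedtSalamonModel.components [FiniteDimensional ℝ 𝔤] (hdim : finrank ℝ 𝔤 = 4)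
    (hk : k = 1 ∨ k = 2) (h : IsDeSmedtSalamonModel g lam k e) (hω : IsAlmostKahler ω J g) :
    k = 2 ∧ ∃ s : ℝ, s ^ 2 = 1 ∧ ω (e 0) (e 1) = 0 ∧ ω (e 0) (e 2) = 0 ∧ ω (e 0) (e 3) = -2 * s ∧
      ω (e 1) (e 2) = s ∧ ω (e 1) (e 3) = 0 ∧ ω (e 2) (e 3) = 0 := by
  obtain ⟨f, hf, f0, f1, f2, f3⟩ := h.exists_frame hdim
  obtain ⟨l01, l02, l03, l12, l13, l23⟩ := h.lie_basis
  have alt := hω.isAlt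
  have c1 := hω.closed (e 0) (e 1) (e 3)
  have c2 := hω.closed (e 0) (e 2) (e 3)
  have c3 := hω.closed (e 0) (e 1) (e 2)
  have hk0 : k ≠ 0 := by rcases hk with rfl | rfl <;> norm_num
  -- the rows of the orthogonal matrix of `J` are unit vectors
  have row : ∀ x, g.form x x = ω x (f 0) ^ 2 + ω x (f 1) ^ 2 + ω x (f 2) ^ 2 + ω x (f 3) ^ 2 :=
    fun x => by
      rw [← hω.compatible, hf.form_eq_sum, Fin.sum_univ_four]
      simp only [hω.form_eq]
      ring
  have r0 := row (f 0)
  have r1 := row (f 1)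
  have r3 := row (f 3)
  rw [hf, if_pos rfl] at r0 r1 r3
  simp [extDeriv₂, l01, l02, l03, l12, l13, l23] at c1 c2 c3
  simp only [f0, f1, f2, f3, map_smul, LinearMap.smul_apply, smul_eq_mul, alt (e _)] at r0 r1 r3
  rw [← alt.neg_eq (e 1) (e 3)] at c1
  rw [← alt.neg_eq (e 2) (e 3)] at c2
  rw [← alt.neg_eq (e 1) (e 2), ← alt.neg_eq (e 0) (e 3), alt (e 1), alt (e 2)] at c3
  rw [← alt.neg_eq (e 0) (e 1)] at r1
  rw [← alt.neg_eq (e 0) (e 3), ← alt.neg_eq (e 1) (e 3), ← alt.neg_eq (e 2) (e 3)] at r3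
  generalize ω (e 0) (e 1) = w01 at *
  generalize ω (e 0) (e 2) = w02 at *
  generalize ω (e 0) (e 3) = w03 at *
  generalize ω (e 1) (e 2) = w12 at *
  generalize ω (e 1) (e 3) = w13 at *
  generalize ω (e 2) (e 3) = w23 at *
  have hpos : 9 + lam ^ 2 ≠ 0 := by positivity
  have h13 : w13 = 0 := (mul_eq_zero.mp (by linear_combination -3 * c1 - lam * c2 :
    (9 + lam ^ 2) * w13 = 0)).resolve_left hpos
  have h23 : w23 = 0 := (mul_eq_zero.mp (by linear_combination lam * c1 - 3 * c2 :
    (9 + lam ^ 2) * w23 = 0)).resolve_left hpos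
  have h03 : w03 = -2 * w12 := by linarith
  subst h13 h23 h03
  have q01 : (k⁻¹ * w01) ^ 2 = 0 := by
    nlinarith [sq_nonneg (k⁻¹ * w01), sq_nonneg (k⁻¹ * w02)]
  have q02 : (k⁻¹ * w02) ^ 2 = 0 := by
    nlinarith [sq_nonneg (k⁻¹ * w01), sq_nonneg (k⁻¹ * w02)]
  have h01 : w01 = 0 :=
    (mul_eq_zero.mp (pow_eq_zero_iff two_ne_zero |>.mp q01)).resolve_left (inv_ne_zero hk0)
  have h02 : w02 = 0 :=
    (mul_eq_zero.mp (pow_eq_zero_iff two_ne_zero |>.mp q02)).resolve_left (inv_ne_zero hk0)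
  subst h01 h02
  have h12 : w12 ^ 2 = 1 := by linarith
  refine ⟨?_, w12, h12, rfl, rfl, rfl, rfl, rfl, rfl⟩
  rcases hk with rfl | rfl
  · exfalso
    rw [inv_one] at r3
    linarith
  · rfl

/-- The 2-form `-2 e^{14} + e^{23} = de^4`. -/
noncomputable def modelForm (e : Basis (Fin 4) ℝ 𝔤) : LinearMap.BilinForm ℝ 𝔤 :=
  (-2 : ℝ) • wedge (e.coord 0) (e.coord 3) + wedge (e.coord 1) (e.coord 2)

theorem modelForm_isAlt : (modelForm e).IsAlt := fun x => by
  simp [modelForm, wedge, mul_comm]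

theorem IsDeSmedtSalamonModel.eq_smul_modelForm [FiniteDimensional ℝ 𝔤] (hdim : finrank ℝ 𝔤 = 4)
    (hk : k = 1 ∨ k = 2) (h : IsDeSmedtSalamonModel g lam k e) (hω : IsAlmostKahler ω J g) :
    k = 2 ∧ ∃ s : ℝ, s ^ 2 = 1 ∧ ω = s • modelForm e := by
  obtain ⟨hk2, s, hs, w01, w02, w03, w12, w13, w23⟩ := h.components hdim hk hω
  refine ⟨hk2, s, hs, sub_eq_zero.mp <| isAlt_eq_zero (f := e) (fun x => ?_) (fun a => ?_)
    fun a => ?_⟩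
  · simp [hω.isAlt x, modelForm_isAlt x]
  · fin_cases a <;> simp [planeIndex, modelForm, wedge, w01, w02, w03, mul_comm]
  · fin_cases a <;>
      simp [coplaneIndex, modelForm, wedge, w23, w12, ← hω.isAlt.neg_eq (e 1) (e 3), w13]

theorem isClosedForm_smul_extDeriv₁ (α : Dual ℝ 𝔤) (c : ℝ) : IsClosedForm (c • extDeriv₁ α) := by
  intro x y z
  have h := congrArg α (lie_jacobi x y z)
  rw [← lie_skew x ⁅y, z⁆, ← lie_skew y ⁅z, x⁆, ← lie_skew z ⁅x, y⁆, ← lie_skew z x, neg_lie] at h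
  simp only [map_add, map_neg, map_zero] at h
  simp only [extDeriv₂, extDeriv₁, LinearMap.smul_apply, LinearMap.mk₂_apply, smul_eq_mul]
  linear_combination -c * h

/-- The endomorphism `J` with `g (J ·, ·) = ω`, for a multiple `ω` of the form of the model. -/
theorem map_frame_of_modelForm {s : ℝ}
    (hJ : ∀ x y, (s • modelForm e) x y = g.form (J x) y) {f : Basis (Fin 4) ℝ 𝔤}
    (hf : IsOrthonormalFrame g f) (f0 : f 0 = (2 : ℝ)⁻¹ • e 0) (f1 : f 1 = e 1) (f2 : f 2 = e 2)
    (f3 : f 3 = e 3) :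
    J (f 0) = -s • f 3 ∧ J (f 1) = s • f 2 ∧ J (f 2) = -s • f 1 ∧ J (f 3) = s • f 0 := by
  refine ⟨?_, ?_, ?_, ?_⟩ <;> refine hf.ext fun j => ?_ <;>
    rw [← hJ, map_smul, LinearMap.smul_apply, LinearMap.smul_apply, LinearMap.smul_apply, hf] <;>
    fin_cases j <;> simp [f0, f1, f2, f3, modelForm, wedge]

/-- The almost complex structure of the model, `g⁻¹ ω`. -/
theorem IsDeSmedtSalamonModel.exists_isAlmostKahler [FiniteDimensional ℝ 𝔤]
    (hdim : finrank ℝ 𝔤 = 4) (h : IsDeSmedtSalamonModel g lam 2 e) {s : ℝ} (hs : s ^ 2 = 1) :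
    ∃ J : End ℝ 𝔤, IsAlmostKahler (s • modelForm e) J g := by
  obtain ⟨f, hf, f0, f1, f2, f3⟩ := h.exists_frame hdim
  have hform : ∀ x y, g.form ((sharp g ∘ₗ (s • modelForm e)) x) y = (s • modelForm e) x y :=
    fun x y => form_sharp g _ y
  set J : End ℝ 𝔤 := sharp g ∘ₗ (s • modelForm e) with hJ
  obtain ⟨J0, J1, J2, J3⟩ := map_frame_of_modelForm (fun x y => (hform x y).symm) hf f0 f1 f2 f3
  have hss : s * s = 1 := by rw [← sq, hs]
  refine ⟨J, ?_, ?_, fun x y => (hform x y).symm, ?_⟩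
  · have : J ∘ₗ J = -LinearMap.id := f.ext fun i => by
      fin_cases i <;> simp [J0, J1, J2, J3, smul_smul, hss]
    exact fun x => congrArg (fun L => L x) this
  · have : g.form.compl₁₂ J J = g.form := f.ext fun i => f.ext fun j => by
      fin_cases i <;> fin_cases j <;> simp [J0, J1, J2, J3, hf _ _, hss]
    exact fun x y => congrArg (fun B => B x y) this
  · have : modelForm e = extDeriv₁ (e.coord 3) := h.d_coord₃.symm
    rw [this]
    exact isClosedForm_smul_extDeriv₁ _ s

theorem IsDeSmedtSalamonModel.isKahler [FiniteDimensional ℝ 𝔤] (hdim : finrank ℝ 𝔤 = 4)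
    (h : IsDeSmedtSalamonModel g lam 2 e) {s : ℝ} (hs : s ^ 2 = 1)
    (hω : IsAlmostKahler (s • modelForm e) J g) : IsKahler (s • modelForm e) J g := by
  obtain ⟨f, hf, f0, f1, f2, f3⟩ := h.exists_frame hdim
  obtain ⟨l01, l02, l03, l12, l13, l23⟩ := h.lie_basis
  have hss : s * s = 1 := by rw [← sq, hs]
  obtain ⟨J0, J1, J2, -⟩ := map_frame_of_modelForm hω.form_eq hf f0 f1 f2 f3
  obtain ⟨b, -, hb⟩ := exists_basis_of_orthonormal (g := g) hdim ![f 0, J (f 0), f 1, J (f 1)] (by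
    intro i j
    fin_cases i <;> fin_cases j <;> simp [J0, J1, hf _ _, hss])
  refine ⟨hω, nijenhuis_eq_zero hω.sq (f := b) ?_ ?_ ?_⟩
  · rw [hb, hb]; rfl
  · rw [hb, hb]; rfl
  · rw [hb, hb]
    change nijenhuis J (f 0) (f 1) = 0
    rw [nijenhuis, J0, J1, f0, f1, f2, f3]
    rw [f1, f2] at J1 J2
    simp only [smul_lie, lie_smul, neg_smul, neg_lie, ← lie_skew (e 3) (e 2),
      ← lie_skew (e 3) (e 1), l23, l13, l02, l01, map_smul, map_add, J1, J2, neg_zero, smul_zero,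
      map_zero, smul_add, smul_sub, smul_smul, smul_neg]
    rw [show s * ((2 : ℝ)⁻¹ * lam) * s = 2⁻¹ * lam by linear_combination 2⁻¹ * lam * hss,
      show s * (2 : ℝ)⁻¹ * s = 2⁻¹ by linear_combination 2⁻¹ * hss]
    abel

/-- Existence of `J` on the model, for a 2-form `ω`. -/
theorem IsDeSmedtSalamonModel.exists_isAlmostKahler_iff [FiniteDimensional ℝ 𝔤]
    (hdim : finrank ℝ 𝔤 = 4) (hk : k = 1 ∨ k = 2) (h : IsDeSmedtSalamonModel g lam k e) :
    (∃ J : End ℝ 𝔤, IsAlmostKahler ω J g) ↔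
      k = 2 ∧ (ω = (-2 : ℝ) • wedge (e.coord 0) (e.coord 3) + wedge (e.coord 1) (e.coord 2) ∨
        ω = (2 : ℝ) • wedge (e.coord 0) (e.coord 3) - wedge (e.coord 1) (e.coord 2)) := by
  have hneg : (2 : ℝ) • wedge (e.coord 0) (e.coord 3) - wedge (e.coord 1) (e.coord 2) =
      (-1 : ℝ) • modelForm e := by
    rw [modelForm, smul_add, smul_smul, neg_one_smul ℝ (wedge _ _), ← sub_eq_add_neg]
    norm_num
  constructor
  · rintro ⟨J, hω⟩
    obtain ⟨hk2, s, hs, rfl⟩ := h.eq_smul_modelForm hdim hk hω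
    refine ⟨hk2, ?_⟩
    rcases mul_self_eq_one_iff.mp ((sq s).symm.trans hs) with rfl | rfl
    · exact Or.inl (one_smul ℝ _)
    · exact Or.inr hneg.symm
  · rintro ⟨rfl, rfl | rfl⟩
    · have := h.exists_isAlmostKahler hdim (one_pow 2)
      rwa [one_smul] at this
    · rw [hneg]
      exact h.exists_isAlmostKahler hdim (by norm_num)

theorem IsDeSmedtSalamonModel.halfSquare_eq_and_isKahler [FiniteDimensional ℝ 𝔤]
    (hdim : finrank ℝ 𝔤 = 4) (hk : k = 1 ∨ k = 2) (h : IsDeSmedtSalamonModel g lam k e)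
    (hω : IsAlmostKahler ω J g) :
    halfSquare ω (e 0) (e 1) (e 2) (e 3) = -k ∧ IsKahler ω J g := by
  obtain ⟨rfl, s, hs, rfl⟩ := h.eq_smul_modelForm hdim hk hω
  refine ⟨?_, h.isKahler hdim hs hω⟩
  simp [halfSquare_apply, modelForm, wedge]
  linear_combination 2 * hs

end Model

end AlmostKahlerLie

theorem mainTheorem3 {𝔤 : Type*} [LieRing 𝔤] [LieAlgebra ℝ 𝔤] [FiniteDimensional ℝ 𝔤]
    (hdim : Module.finrank ℝ 𝔤 = 4) (g : AlmostKahlerLie.Metric 𝔤) :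
    -- every self-dual, non-conformally-flat almost-Kähler structure is Kähler
    (∀ (ω : LinearMap.BilinForm ℝ 𝔤) (J : Module.End ℝ 𝔤),
      AlmostKahlerLie.IsAlmostKahler ω J g →
      AlmostKahlerLie.IsSelfDual g (AlmostKahlerLie.halfSquare ω) →
      ¬ AlmostKahlerLie.IsConformallyFlat g (AlmostKahlerLie.halfSquare ω) →
      AlmostKahlerLie.IsKahler ω J g) ∧
    -- the compatible symplectic forms in the De Smedt–Salamon model
    (∀ (lam k : ℝ) (e : Module.Basis (Fin 4) ℝ 𝔤), 0 ≤ lam → (k = 1 ∨ k = 2) →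
      AlmostKahlerLie.IsDeSmedtSalamonModel g lam k e →
      (∀ ω : LinearMap.BilinForm ℝ 𝔤,
        (∃ J : Module.End ℝ 𝔤, AlmostKahlerLie.IsAlmostKahler ω J g) ↔
          k = 2 ∧
            (ω = (-2 : ℝ) • AlmostKahlerLie.wedge (e.coord 0) (e.coord 3) +
                AlmostKahlerLie.wedge (e.coord 1) (e.coord 2) ∨
              ω = (2 : ℝ) • AlmostKahlerLie.wedge (e.coord 0) (e.coord 3) -
                AlmostKahlerLie.wedge (e.coord 1) (e.coord 2))) ∧
      (∀ (ω : LinearMap.BilinForm ℝ 𝔤) (J : Module.End ℝ 𝔤),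
        AlmostKahlerLie.IsAlmostKahler ω J g →
        AlmostKahlerLie.halfSquare ω (e 0) (e 1) (e 2) (e 3) = -k ∧
        AlmostKahlerLie.IsKahler ω J g)) := by
  refine ⟨fun ω J h hsd hcf => h.isKahler_of_isSelfDual hdim hsd hcf,
    fun lam k e _ hk h => ⟨?_, ?_⟩⟩
  · exact fun ω => h.exists_isAlmostKahler_iff hdim hk
  · exact fun ω J hω => h.halfSquare_eq_and_isKahler hdim hk hω
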